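/- **Setting.** Let $d\ge 2$ and $k$ be fixed integers. Let $[n]$ be the node set, let $\mathcal E=\binom{[n]}{d}$ be the set of possible edges, and let $\Psi:[n]\to[k]$ be a partition of the nodes into $k$ groups. In the weighted stochastic block model with parameters $p>q\ge 0$ and $\alpha_n$, the edge weights $W_e\in[0,1]$, $e\in\mathcal E$, are independent random variables with $\mathbb E[W_e]=p\,\alpha_n$ if $\Psi$ is constant on $e$, and $\mathbb E[W_e]=q\,\alpha_n$ otherwise. The similarity matrix $A\in\mathbb R^{n\times n}$ is $A_{ij}=\sum_{e\supset\{i,j\}}W_e$ for $i\ne j$ and $A_{ii}=0$. For a constant $c_{\mathrm{thr}}>0$, the processed similarity matrix $A^0$ is obtained from $A$ by setting to zero row $i$ and column $i$ for every $i$ with $\sum_j A_{ij}>c_{\mathrm{thr}}\,\frac1n\sum_{i',j}A_{i'j}$. Let $Z\in\{0,1\}^{n\times k}$ be the membership matrix ($Z_{i\ell}=1$ iff $\Psi(i)=\ell$). Let $B\in\mathbb R^{k\times k}$ be given by $B_{\ell m}=\mathbb E[A_{ij}]$ for some (equivalently, any) $i\neq j$ with $\Psi(i)=\ell$, $\Psi(j)=m$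 (and $B_{\ell m}=0$ if there is no such pair). Put $P=ZBZ^{T}$. Let $\|\cdot\|$ be the spectral norm. **Lemma.** For all integers $d\ge2$ and $k$ there are constants $c_{\mathrm{thr}},c_5,C>0$, depending only on $d$ and $k$, such that for all real $p>q\ge0$ and $K$ there is a constant $c_4>0$ (depending only on $d,k,p,q,K$) with the following property. For every $n$, every $\Psi:[n]\to[k]$, every real $\alpha_n$, and every family of weights as above, if $$n\binom{n-2}{d-2}p\,\alpha_n\ \ge\ c_5\qquad\text{and}\qquad \binom{n-2}{d-2}\alpha_n\ \le\ K\,n,$$ then, with probability at least $1-C/n$, $$\|A^0-P\|\ \le\ c_4\sqrt{n\binom{n-2}{d-2}\alpha_n}.$$ (Binomial coefficients are used with $n-2$ replaced by $0$ when $n<2$.) -/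

import Mathlib

open MeasureTheory ProbabilityTheory

noncomputable section

/-- The possible hyperedges: the subsets of size `d` of the node set `{1, …, n}`. -/
abbrev HEdge (n d : ℕ) : Type := {e : Finset (Fin n) // e.card = d}

/-- An edge is homogeneous if all its nodes lie in the same group of the partition `Ψ`. -/
def IsHomogeneous {n d k : ℕ} (Ψ : Fin n → Fin k) (e : HEdge n d) : Prop :=
  ∀ i ∈ e.1, ∀ j ∈ e.1, Ψ i = Ψ j

/-- The weighted stochastic block model with parameters `p`, `q`, `α` and hidden partition `Ψ`:
independent random edge weights in `[0, 1]`, with expectation `p * α` on homogeneous edges and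
`q * α` on heterogeneous edges. Nothing else is assumed about their distributions. -/
structure IsWeightedSBM {Ω : Type*} [MeasurableSpace Ω] (μ : Measure Ω) {n d k : ℕ}
    (Ψ : Fin n → Fin k) (p q α : ℝ) (W : HEdge n d → Ω → ℝ) : Prop where
  measurable_weight : ∀ e, Measurable (W e)
  weight_mem : ∀ e ω, W e ω ∈ Set.Icc (0 : ℝ) 1
  indep : iIndepFun W μ
  mean_homogeneous : ∀ e, IsHomogeneous Ψ e → ∫ ω, W e ω ∂μ = p * α
  mean_heterogeneous : ∀ e, ¬ IsHomogeneous Ψ e → ∫ ω, W e ω ∂μ = q * α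

/-- The similarity matrix: off the diagonal, the entry `(i, j)` is the total weight of the edges
that contain both `i` and `j`; the diagonal is zero. -/
def similarityMatrix {n d : ℕ} (w : HEdge n d → ℝ) : Matrix (Fin n) (Fin n) ℝ :=
  Matrix.of fun i j =>
    if i = j then 0 else ∑ e : HEdge n d, if i ∈ e.1 ∧ j ∈ e.1 then w e else 0

/-- Row `i` of `A` is removed if its sum exceeds `c` times the average row sum. -/
def IsRemoved {n : ℕ} (c : ℝ) (A : Matrix (Fin n) (Fin n) ℝ) (i : Fin n) : Prop :=
  ∑ j, A i j > c * ((1 / (n : ℝ)) * ∑ i', ∑ j, A i' j)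

open Classical in
/-- The processed matrix: the removed rows and the corresponding columns are set to zero. -/
def processedMatrix {n : ℕ} (c : ℝ) (A : Matrix (Fin n) (Fin n) ℝ) :
    Matrix (Fin n) (Fin n) ℝ :=
  Matrix.of fun i j => if IsRemoved c A i ∨ IsRemoved c A j then 0 else A i j

/-- The membership matrix of the partition `Ψ`. -/
def membershipMatrix {n k : ℕ} (Ψ : Fin n → Fin k) : Matrix (Fin n) (Fin k) ℝ :=
  Matrix.of fun i l => if Ψ i = l then 1 else 0

open Classical in
/-- The `k × k` matrix whose entry `(l, m)` is `𝔼[A i j]` for some distinct nodes `i` of group `l`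
and `j` of group `m` (in the block model it does not matter which), and `0` if there are no such
nodes, which happens only if one of the groups is empty or `l = m` is a group with one node. -/
def blockMatrix {Ω : Type*} [MeasurableSpace Ω] (μ : Measure Ω) {n d k : ℕ}
    (Ψ : Fin n → Fin k) (W : HEdge n d → Ω → ℝ) : Matrix (Fin k) (Fin k) ℝ :=
  Matrix.of fun l m =>
    if h : ∃ ij : Fin n × Fin n, ij.1 ≠ ij.2 ∧ Ψ ij.1 = l ∧ Ψ ij.2 = m then
      ∫ ω, similarityMatrix (fun e => W e ω) h.choose.1 h.choose.2 ∂μ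
    else 0

/-- The matrix `P = Z B Zᵀ`, which agrees with `𝔼[A]` off the diagonal. -/
def populationMatrix {Ω : Type*} [MeasurableSpace Ω] (μ : Measure Ω) {n d k : ℕ}
    (Ψ : Fin n → Fin k) (W : HEdge n d → Ω → ℝ) : Matrix (Fin n) (Fin n) ℝ :=
  membershipMatrix Ψ * blockMatrix μ Ψ W * (membershipMatrix Ψ).transpose

/-- The spectral norm of a real square matrix: its operator norm on Euclidean space. -/
def matrixSpectralNorm {n : ℕ} (M : Matrix (Fin n) (Fin n) ℝ) : ℝ :=
  ‖Matrix.toEuclideanCLM (n := Fin n) (𝕜 := ℝ) M‖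

end

/-! This is the Kahn–Szemerédi argument, in the form used by Feige and Ofek for sparse graphs, run
on hyperedges. Put `D = n * (n - 2).choose (d - 2) * (p * α)`. All entries of `P` and `𝔼[A]` lie in
`[0, D / n]`, and a net reduces the claim to `|∑ u i * v j * (A⁰ - P) i j| ≲ n * √D` for `e^{O(n)}`
lattice vectors `u`, `v` of squared norm at most `n`. Entries of `A` that share a hyperedge are
dependent, so each bilinear form `∑ g i j * A i j` is rewritten as `∑ edgeSum g e * W e`, a weighted
sum of independent variables, and one Chernoff bound (`chernoff_weighted_sum`) serves everywhere.

Pairs `(i, j)` are sorted by the dyadic levels of `u i` and `v j` and cut where the product is about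
`√D`. On light pairs the coefficients are `O(√D)` and the variance is `O(n * D)`, so a deviation of
order `n * √D` has probability `e^{-37n}`, which survives a union bound over pairs of net vectors
(`measure_not_hasLightBound_le`).

On heavy pairs no such union bound is affordable. Instead, all rectangles `I × J` are controlled
simultaneously (`HasBoundedDiscrepancy`), at the price of the entropies of `I` and `J`. The
inequality is linear in the weight of the rectangle, with a free parameter `m`, because it comes
from Chernoff with slope proportional to `m * log 2`; `m` is later the amount by which the two
levels exceed the cut. If the levels are comparable, the sum over levels of the entropy errors
converges geometrically (`balanced_heavy_sum_le`). If one level dominates, only bounded row sums are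
needed (`unbalanced_heavy_sum_le`), and this is what the trimming provides.

The trimmed set depends on `A`, but deleting rows and columns amounts to zeroing coordinates of `u`
and `v`, and the net is closed under that; estimates for the untrimmed `A` therefore apply without a
union over trimmed sets. The total weight is of order `n * D`, thanks to the homogeneous edges in a
largest group, so a removed row has sum at least a large multiple of `D`; discrepancy allows at most
`n / D` of these, and the part of `P` lost is negligible. Finally `P` and `𝔼[A]` differ only on the
diagonal, by at most `D / n`; the upper bound on `α` makes this harmless. -/

/-! ### A Chernoff bound for weighted sums of independent `[0, 1]`-valued variables -/

/-- On `[0, 1]` the function `exp (b x)` lies below its chord. -/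
theorem exp_mul_le_chord (b : ℝ) {x : ℝ} (hx : x ∈ Set.Icc (0 : ℝ) 1) :
    Real.exp (b * x) ≤ 1 + x * (Real.exp b - 1) := by
  have h := convexOn_exp.2 (Set.mem_univ 0) (Set.mem_univ b) (sub_nonneg.2 hx.2) hx.1 (by ring)
  simp only [smul_eq_mul, mul_zero, zero_add, Real.exp_zero, mul_one] at h
  rw [mul_comm b x]
  linarith

theorem integrable_of_mem_Icc {Ω : Type*} [MeasurableSpace Ω] {μ : Measure Ω}
    [IsFiniteMeasure μ] {f : Ω → ℝ} {a b : ℝ} (hf : Measurable f)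
    (h : ∀ ω, f ω ∈ Set.Icc a b) : Integrable f μ :=
  Integrable.of_mem_Icc a b hf.aemeasurable (ae_of_all _ h)

theorem mgf_le_exp_mul_mean {Ω : Type*} [MeasurableSpace Ω] {μ : Measure Ω}
    [IsProbabilityMeasure μ] {f : Ω → ℝ} (hf : Measurable f)
    (h : ∀ ω, f ω ∈ Set.Icc (0 : ℝ) 1) (b : ℝ) :
    mgf (fun ω => b * f ω) μ 1 ≤ Real.exp ((∫ ω, f ω ∂μ) * (Real.exp b - 1)) := by
  have hi : Integrable f μ := integrable_of_mem_Icc hf h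
  have hle : mgf (fun ω => b * f ω) μ 1 ≤ ∫ ω, (1 + f ω * (Real.exp b - 1)) ∂μ := by
    refine integral_mono_of_nonneg (ae_of_all _ fun ω => (Real.exp_pos _).le)
      ((integrable_const _).add (hi.mul_const _)) (ae_of_all _ fun ω => ?_)
    simpa using exp_mul_le_chord b (h ω)
  rw [integral_add (integrable_const _) (hi.mul_const _), integral_mul_const] at hle
  simp only [integral_const, probReal_univ, smul_eq_mul, mul_one] at hle
  linarith [Real.add_one_le_exp ((∫ ω, f ω ∂μ) * (Real.exp b - 1))]

/-- The compensator is left unexpanded, as for a Poisson variable, so that the same bound serves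
small slopes (light pairs), slopes up to `m * log 2` (discrepancy) and slope `-1` (lower tail of the
total weight). -/
theorem chernoff_weighted_sum {Ω ι : Type*} [Fintype ι] [MeasurableSpace Ω] {μ : Measure Ω}
    [IsProbabilityMeasure μ] {W : ι → Ω → ℝ} (hW : ∀ e, Measurable (W e))
    (h01 : ∀ e ω, W e ω ∈ Set.Icc (0 : ℝ) 1) (hind : iIndepFun W μ) (b : ι → ℝ) (s : ℝ) :
    μ.real {ω | ∑ e, (∫ ω, W e ω ∂μ) * (Real.exp (b e) - 1) + s ≤ ∑ e, b e * W e ω}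
      ≤ Real.exp (-s) := by
  have hb : ∀ e, Measurable fun ω => b e * W e ω := fun e => (hW e).const_mul _
  have hind' : iIndepFun (fun e ω => b e * W e ω) μ :=
    hind.comp (fun e x => b e * x) fun e => measurable_const_mul _
  have hint : ∀ e, Integrable (fun ω => Real.exp (1 * (b e * W e ω))) μ := by
    intro e
    refine integrable_of_mem_Icc (a := 0) (b := Real.exp |b e|)
      (((hb e).const_mul 1).exp) fun ω => ⟨(Real.exp_pos _).le, Real.exp_le_exp.2 ?_⟩
    rw [one_mul]
    calc b e * W e ω ≤ |b e * W e ω| := le_abs_self _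
      _ = |b e| * W e ω := by rw [abs_mul, abs_of_nonneg (h01 e ω).1]
      _ ≤ |b e| := mul_le_of_le_one_right (abs_nonneg _) (h01 e ω).2
  have key := measure_ge_le_exp_mul_mgf (μ := μ) (X := ∑ e, fun ω => b e * W e ω) (t := 1)
    (∑ e, (∫ ω, W e ω ∂μ) * (Real.exp (b e) - 1) + s) zero_le_one
    (hind'.integrable_exp_mul_sum hb fun e _ => hint e)
  rw [hind'.mgf_sum hb] at key
  simp only [Finset.sum_apply] at key
  refine key.trans ?_
  calc _ ≤ Real.exp (-1 * (∑ e, (∫ ω, W e ω ∂μ) * (Real.exp (b e) - 1) + s)) *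
        ∏ e, Real.exp ((∫ ω, W e ω ∂μ) * (Real.exp (b e) - 1)) := by
        refine mul_le_mul_of_nonneg_left ?_ (Real.exp_pos _).le
        exact Finset.prod_le_prod (fun e _ => mgf_nonneg)
          fun e _ => mgf_le_exp_mul_mean (hW e) (h01 e) (b e)
    _ = Real.exp (-s) := by
        rw [← Real.exp_sum, ← Real.exp_add]
        ring_nf

/-! ### The entropy of a subset -/

/-- The logarithm of `(e n / r) ^ r`, which bounds the number of `r`-subsets of an `n`-set. -/
noncomputable def subsetEntropy (n r : ℕ) : ℝ := r * (1 + Real.log (n / r))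

/-- Combine `choose n r ≤ n ^ r / r!` with `r ^ r / r! ≤ e ^ r`. -/
theorem choose_le_exp_subsetEntropy {n r : ℕ} (hr : 0 < r) (hrn : r ≤ n) :
    (n.choose r : ℝ) ≤ Real.exp (subsetEntropy n r) := by
  have hr' : (0 : ℝ) < r := by exact_mod_cast hr
  have hn' : (0 : ℝ) < n := by exact_mod_cast hr.trans_le hrn
  have hfac : (0 : ℝ) < r.factorial := by exact_mod_cast r.factorial_pos
  have h1 := Nat.choose_le_pow_div (α := ℝ) r n
  have h2 := Real.pow_div_factorial_le_exp (r : ℝ) hr'.le r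
  have h3 : Real.exp (subsetEntropy n r) = Real.exp r * ((n : ℝ) / r) ^ r := by
    rw [subsetEntropy, mul_add, mul_one, Real.exp_add, mul_comm (r : ℝ) (Real.log _),
      Real.exp_mul, Real.exp_log (by positivity), Real.rpow_natCast]
  rw [h3]
  refine h1.trans ?_
  calc (n : ℝ) ^ r / r.factorial = (r : ℝ) ^ r / r.factorial * (n / r) ^ r := by
        rw [div_pow]; field_simp
    _ ≤ _ := mul_le_mul_of_nonneg_right h2 (by positivity)

theorem log_le_subsetEntropy {n r : ℕ} (hr : 0 < r) (hrn : r ≤ n) :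
    Real.log n ≤ subsetEntropy n r := by
  have hr' : (1 : ℝ) ≤ r := by exact_mod_cast hr
  have hrn' : (r : ℝ) ≤ n := by exact_mod_cast hrn
  have hlog : 0 ≤ Real.log ((n : ℝ) / r) :=
    Real.log_nonneg ((one_le_div (by linarith)).2 hrn')
  have h1 : Real.log n = Real.log r + Real.log ((n : ℝ) / r) := by
    rw [Real.log_div (by linarith) (by linarith)]; ring
  have h2 := Real.log_le_sub_one_of_pos (show (0 : ℝ) < r by linarith)
  rw [subsetEntropy, h1]
  nlinarith

theorem subsetEntropy_nonneg {n r : ℕ} (hrn : r ≤ n) : 0 ≤ subsetEntropy n r := by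
  rcases Nat.eq_zero_or_pos r with rfl | hr
  · simp [subsetEntropy]
  · exact (Real.log_natCast_nonneg n).trans (log_le_subsetEntropy hr hrn)

theorem subsetEntropy_le {n r : ℕ} (hrn : r ≤ n) : subsetEntropy n r ≤ n := by
  rcases Nat.eq_zero_or_pos r with rfl | hr
  · simp [subsetEntropy]
  have hr' : (0 : ℝ) < r := by exact_mod_cast hr
  have hn' : (0 : ℝ) < n := by exact_mod_cast hr.trans_le hrn
  have h := Real.log_le_sub_one_of_pos (div_pos hn' hr')
  calc subsetEntropy n r ≤ r * (n / r) := by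
        rw [subsetEntropy]; exact mul_le_mul_of_nonneg_left (by linarith) hr'.le
    _ = n := by field_simp

/-- Young's inequality for the entropy. -/
theorem subsetEntropy_le_add {n r : ℕ} (hrn : r ≤ n) (l : ℝ) :
    subsetEntropy n r ≤ r * (1 + l) + n * Real.exp (-l) := by
  rcases Nat.eq_zero_or_pos r with rfl | hr
  · simp [subsetEntropy]; positivity
  have hr' : (0 : ℝ) < r := by exact_mod_cast hr
  have hn' : (0 : ℝ) < n := by exact_mod_cast hr.trans_le hrn
  -- The tangent inequality `log x ≤ x - 1` at `x = (n / r) * exp (-l)`.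
  have hpos : 0 < (n : ℝ) / r * Real.exp (-l) := by positivity
  have h := Real.log_le_sub_one_of_pos hpos
  rw [Real.log_mul (by positivity) (Real.exp_pos _).ne', Real.log_exp] at h
  have h' := mul_le_mul_of_nonneg_left h hr'.le
  have h2 : (r : ℝ) * (n / r * Real.exp (-l) - 1) = n * Real.exp (-l) - r := by field_simp
  rw [h2] at h'
  rw [subsetEntropy]
  linarith

-- One of the three copies of the entropy pays for the number of sets of each size, the other two
-- give `n⁻²`, and there are `n` sizes.
open Classical in
theorem sum_exp_neg_subsetEntropy_le (n : ℕ) :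
    ∑ I : Finset (Fin n) with I.Nonempty, Real.exp (-(3 * subsetEntropy n I.card))
      ≤ (n : ℝ) * Real.exp (-(2 * Real.log n)) := by
  have hterm : ∀ I : Finset (Fin n), I.Nonempty →
      Real.exp (-(3 * subsetEntropy n I.card)) ≤
        Real.exp (-(2 * Real.log n)) * Real.exp (-subsetEntropy n I.card) := by
    intro I hI
    rw [← Real.exp_add, Real.exp_le_exp]
    have := log_le_subsetEntropy (n := n) hI.card_pos (by simpa using I.card_le_univ)
    linarith
  have hsum : ∑ I : Finset (Fin n) with I.Nonempty, Real.exp (-subsetEntropy n I.card) ≤ n := by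
    have h1 : ∑ I : Finset (Fin n) with I.Nonempty, Real.exp (-subsetEntropy n I.card)
        = ∑ I ∈ (Finset.univ : Finset (Fin n)).powerset,
          if 0 < I.card then Real.exp (-subsetEntropy n I.card) else 0 := by
      rw [Finset.powerset_univ, Finset.sum_filter]
      simp only [Finset.card_pos]
    rw [h1, Finset.sum_powerset_apply_card
      (fun r => if 0 < r then Real.exp (-subsetEntropy n r) else 0), Finset.sum_range_succ']
    simp only [Finset.card_univ, Fintype.card_fin, Nat.succ_pos, if_true, lt_irrefl, if_false,
      smul_zero, add_zero, nsmul_eq_mul]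
    calc _ ≤ ∑ r ∈ Finset.range n, (1 : ℝ) := by
          refine Finset.sum_le_sum fun r hr => ?_
          have hr' : r + 1 ≤ n := Finset.mem_range.1 hr
          calc _ ≤ Real.exp (subsetEntropy n (r + 1)) * Real.exp (-subsetEntropy n (r + 1)) :=
                mul_le_mul_of_nonneg_right (choose_le_exp_subsetEntropy r.succ_pos hr')
                  (Real.exp_pos _).le
            _ = 1 := by rw [← Real.exp_add]; simp
      _ = n := by simp
  calc _ ≤ ∑ I : Finset (Fin n) with I.Nonempty,
        Real.exp (-(2 * Real.log n)) * Real.exp (-subsetEntropy n I.card) :=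
        Finset.sum_le_sum fun I hI => hterm I (Finset.mem_filter.1 hI).2
    _ = Real.exp (-(2 * Real.log n)) *
        ∑ I : Finset (Fin n) with I.Nonempty, Real.exp (-subsetEntropy n I.card) := by
        rw [Finset.mul_sum]
    _ ≤ _ := by
        rw [mul_comm (n : ℝ)]
        exact mul_le_mul_of_nonneg_left hsum (Real.exp_pos _).le

/-! ### A lattice net of the ball -/

theorem sum_half_pow_natAbs_le (M : ℕ) :
    ∑ z ∈ Finset.Icc (-(M : ℤ)) M, (1 / 2 : ℝ) ^ z.natAbs ≤ 4 := by
  classical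
  have hsub : Finset.Icc (-(M : ℤ)) M ⊆
      (Finset.range (M + 1)).image (fun m : ℕ => (m : ℤ)) ∪
        (Finset.range (M + 1)).image (fun m : ℕ => -(m : ℤ)) := by
    intro z hz
    rw [Finset.mem_Icc] at hz
    simp only [Finset.mem_union, Finset.mem_image, Finset.mem_range]
    rcases le_total 0 z with h | h
    · exact Or.inl ⟨z.natAbs, by omega, by omega⟩
    · exact Or.inr ⟨z.natAbs, by omega, by omega⟩
  have hgeo := sum_geometric_two_le (M + 1)
  have hnn : ∀ z : ℤ, (0 : ℝ) ≤ (1 / 2 : ℝ) ^ z.natAbs := fun z => by positivity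
  calc _ ≤ ∑ z ∈ (Finset.range (M + 1)).image (fun m : ℕ => (m : ℤ)) ∪
        (Finset.range (M + 1)).image (fun m : ℕ => -(m : ℤ)), (1 / 2 : ℝ) ^ z.natAbs :=
        Finset.sum_le_sum_of_subset_of_nonneg hsub fun z _ _ => hnn z
    _ ≤ ∑ z ∈ (Finset.range (M + 1)).image (fun m : ℕ => (m : ℤ)), (1 / 2 : ℝ) ^ z.natAbs +
        ∑ z ∈ (Finset.range (M + 1)).image (fun m : ℕ => -(m : ℤ)), (1 / 2 : ℝ) ^ z.natAbs := by
        rw [← Finset.sum_union_inter]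
        exact le_add_of_nonneg_right (Finset.sum_nonneg fun z _ => hnn z)
    _ ≤ 4 := by
        rw [Finset.sum_image (by intro a _ b _ h; simpa using h),
          Finset.sum_image (by intro a _ b _ h; simpa using h)]
        simp only [Int.natAbs_natCast, Int.natAbs_neg]
        linarith

/-- The integer vectors of `ℓ¹` norm at most `16 n`. -/
noncomputable def latticeNet (n : ℕ) : Finset (Fin n → ℤ) :=
  (Fintype.piFinset fun _ => Finset.Icc (-((16 * n : ℕ) : ℤ)) ((16 * n : ℕ) : ℤ)).filter
    fun z => ∑ i, (z i).natAbs ≤ 16 * n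

theorem mem_latticeNet {n : ℕ} {z : Fin n → ℤ} :
    z ∈ latticeNet n ↔ ∑ i, (z i).natAbs ≤ 16 * n := by
  rw [latticeNet, Finset.mem_filter, and_iff_right_iff_imp]
  intro h
  rw [Fintype.mem_piFinset]
  intro i
  have := (Finset.single_le_sum (f := fun i => (z i).natAbs) (fun _ _ => Nat.zero_le _)
    (Finset.mem_univ i)).trans h
  rw [Finset.mem_Icc]
  omega

/-- Each net vector has weight `∏ 2^(-|z i|)` at least `2^(-16n)`, while the total weight of all
vectors factorises over coordinates and is at most `4^n`. -/
theorem card_latticeNet_le (n : ℕ) : ((latticeNet n).card : ℝ) ≤ Real.exp (18 * n) := by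
  have h1 : ((latticeNet n).card : ℝ) ≤
      ∑ z ∈ latticeNet n, 2 ^ (16 * n) * ∏ i, (1 / 2 : ℝ) ^ (z i).natAbs := by
    rw [Finset.card_eq_sum_ones, Nat.cast_sum]
    refine Finset.sum_le_sum fun z hz => ?_
    rw [Finset.prod_pow_eq_pow_sum, Nat.cast_one, one_div, inv_pow, ← div_eq_mul_inv,
      one_le_div (by positivity)]
    exact pow_le_pow_right₀ one_le_two (mem_latticeNet.1 hz)
  have h2 : ∑ z ∈ latticeNet n, 2 ^ (16 * n) * ∏ i, (1 / 2 : ℝ) ^ (z i).natAbs ≤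
      2 ^ (16 * n) * 4 ^ n := by
    rw [← Finset.mul_sum]
    refine mul_le_mul_of_nonneg_left ?_ (by positivity)
    calc _ ≤ ∑ z ∈ Fintype.piFinset fun _ : Fin n =>
          Finset.Icc (-((16 * n : ℕ) : ℤ)) ((16 * n : ℕ) : ℤ),
          ∏ i, (1 / 2 : ℝ) ^ (z i).natAbs :=
          Finset.sum_le_sum_of_subset_of_nonneg (Finset.filter_subset _ _)
            fun z _ _ => Finset.prod_nonneg fun i _ => by positivity
      _ = ∏ _i : Fin n, ∑ z ∈ Finset.Icc (-((16 * n : ℕ) : ℤ)) ((16 * n : ℕ) : ℤ),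
          (1 / 2 : ℝ) ^ z.natAbs :=
          (Finset.prod_univ_sum (fun _ : Fin n =>
            Finset.Icc (-((16 * n : ℕ) : ℤ)) ((16 * n : ℕ) : ℤ))
            fun _ z => (1 / 2 : ℝ) ^ z.natAbs).symm
      _ ≤ ∏ _i : Fin n, (4 : ℝ) :=
          Finset.prod_le_prod (fun _ _ => Finset.sum_nonneg fun z _ => by positivity)
            fun _ _ => sum_half_pow_natAbs_le _
      _ = 4 ^ n := by simp
  have he : (2 : ℝ) ≤ Real.exp 1 := by linarith [Real.add_one_le_exp (1 : ℝ)]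
  calc _ ≤ (2 : ℝ) ^ (16 * n) * 4 ^ n := h1.trans h2
    _ = 2 ^ (18 * n) := by
        rw [show (4 : ℝ) = 2 ^ 2 by norm_num, ← pow_mul, ← pow_add]; ring_nf
    _ ≤ Real.exp 1 ^ (18 * n) := pow_le_pow_left₀ zero_le_two he _
    _ = _ := by rw [← Real.exp_nat_mul]; push_cast; ring_nf

/-- Rounding is towards zero, so that it does not increase the norm. -/
theorem exists_int_near (x : ℝ) :
    ∃ z : ℤ, |(z : ℝ)| ≤ |x| ∧ |x - z| ≤ 1 := by
  rcases le_total 0 x with h | h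
  · refine ⟨⌊x⌋, ?_, ?_⟩
    · rw [abs_of_nonneg h, abs_of_nonneg (by exact_mod_cast Int.floor_nonneg.2 h)]
      exact Int.floor_le x
    · rw [abs_of_nonneg (sub_nonneg.2 (Int.floor_le x))]
      linarith [Int.lt_floor_add_one x]
  · refine ⟨⌈x⌉, ?_, ?_⟩
    · have h' : ((⌈x⌉ : ℤ) : ℝ) ≤ 0 := by exact_mod_cast Int.ceil_le.2 (by simpa using h)
      rw [abs_of_nonpos h, abs_of_nonpos h']
      linarith [Int.le_ceil x]
    · rw [abs_of_nonpos (sub_nonpos.2 (Int.le_ceil x))]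
      linarith [Int.ceil_lt_add_one x]

theorem exists_latticeNet_near {n : ℕ} (u : Fin n → ℝ) (hu : ∑ i, u i ^ 2 ≤ n) :
    ∃ z ∈ latticeNet n, ∑ i, ((z i : ℝ) / 4) ^ 2 ≤ (n : ℝ) ∧
      ∑ i, (u i - (z i : ℝ) / 4) ^ 2 ≤ (n : ℝ) / 16 := by
  choose z hz1 hz2 using fun i => exists_int_near (4 * u i)
  have hsq : ∀ i, ((z i : ℝ) / 4) ^ 2 ≤ u i ^ 2 := by
    intro i
    have := sq_le_sq.2 (hz1 i)
    nlinarith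
  have hsum : ∑ i, ((z i : ℝ) / 4) ^ 2 ≤ (n : ℝ) := (Finset.sum_le_sum fun i _ => hsq i).trans hu
  refine ⟨z, mem_latticeNet.2 ?_, hsum, ?_⟩
  -- Integers satisfy `|z| ≤ z²`, so the `ℓ¹` norm is at most the squared `ℓ²` norm, that is `16 n`.
  · have h1 : ∀ i, (((z i).natAbs : ℕ) : ℝ) ≤ 16 * ((z i : ℝ) / 4) ^ 2 := by
      intro i
      have h : ((z i).natAbs : ℤ) ≤ (z i) ^ 2 := by
        rw [← Int.natAbs_sq]
        exact_mod_cast Nat.le_self_pow two_ne_zero _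
      have h' : (((z i).natAbs : ℕ) : ℝ) ≤ (z i : ℝ) ^ 2 := by
        rw [Int.natCast_natAbs] at h
        rw [Nat.cast_natAbs]
        exact_mod_cast h
      linarith
    have h2 : ((∑ i, (z i).natAbs : ℕ) : ℝ) ≤ 16 * n := by
      rw [Nat.cast_sum]
      refine (Finset.sum_le_sum fun i _ => h1 i).trans ?_
      rw [← Finset.mul_sum]
      linarith
    exact_mod_cast h2
  · calc ∑ i, (u i - (z i : ℝ) / 4) ^ 2 ≤ ∑ _i : Fin n, (1 / 16 : ℝ) := by
          refine Finset.sum_le_sum fun i _ => ?_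
          have := sq_le_sq.2 (show |4 * u i - z i| ≤ |(1 : ℝ)| by simpa using hz2 i)
          nlinarith
      _ = (n : ℝ) / 16 := by simp [div_eq_mul_inv]

theorem inner_toEuclideanCLM {n : ℕ} (M : Matrix (Fin n) (Fin n) ℝ)
    (x y : EuclideanSpace ℝ (Fin n)) :
    inner ℝ (Matrix.toEuclideanCLM (n := Fin n) (𝕜 := ℝ) M y) x
      = ∑ i, ∑ j, x i * y j * M i j := by
  rw [PiLp.inner_apply]
  refine Finset.sum_congr rfl fun i _ => ?_
  simp only [Matrix.ofLp_toEuclideanCLM, Matrix.mulVec, dotProduct]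
  simp only [RCLike.inner_apply, conj_trivial, Finset.mul_sum]
  exact Finset.sum_congr rfl fun j _ => by ring

theorem exists_scaled_latticeNet_near {n : ℕ} (hn : 0 < n) (x : EuclideanSpace ℝ (Fin n))
    (hx : ‖x‖ = 1) :
    ∃ z ∈ latticeNet n, ∑ i, ((z i : ℝ) / 4) ^ 2 ≤ (n : ℝ) ∧
      ∃ x' : EuclideanSpace ℝ (Fin n), (∀ i, x' i = (√n)⁻¹ * ((z i : ℝ) / 4)) ∧
        ‖x'‖ ≤ 1 ∧ ‖x - x'‖ ≤ 1 / 4 := by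
  have hn' : (0 : ℝ) < n := by exact_mod_cast hn
  have hs : √(n : ℝ) ^ 2 = n := Real.sq_sqrt hn'.le
  have hs0 : 0 < √(n : ℝ) := Real.sqrt_pos.2 hn'
  have hx2 : ∑ i, x i ^ 2 = 1 := by
    have := EuclideanSpace.real_norm_sq_eq x
    rw [hx] at this
    linarith
  obtain ⟨z, hz, hz1, hz2⟩ := exists_latticeNet_near (fun i => √(n : ℝ) * x i) (by
    simp only [mul_pow, hs]
    rw [← Finset.mul_sum, hx2, mul_one])
  refine ⟨z, hz, hz1, WithLp.toLp 2 fun i => (√n)⁻¹ * ((z i : ℝ) / 4), fun i => rfl, ?_, ?_⟩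
  · rw [← sq_le_one_iff₀ (norm_nonneg _), EuclideanSpace.real_norm_sq_eq]
    simp only [mul_pow, inv_pow, hs]
    rw [← Finset.mul_sum, inv_mul_le_one₀ hn']
    simpa only [mul_pow] using hz1
  · rw [← sq_le_sq₀ (norm_nonneg _) (by norm_num), EuclideanSpace.real_norm_sq_eq]
    have h : ∀ i, (x - WithLp.toLp 2 fun i => (√(n : ℝ))⁻¹ * ((z i : ℝ) / 4) :
        EuclideanSpace ℝ (Fin n)) i ^ 2 = (n : ℝ)⁻¹ * (√n * x i - (z i : ℝ) / 4) ^ 2 := by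
      intro i
      rw [← hs, ← inv_pow, ← mul_pow, hs]
      congr 1
      simp only [PiLp.sub_apply]
      field_simp
    simp only [h]
    rw [← Finset.mul_sum, inv_mul_le_iff₀ hn']
    linarith

/-- After division by `√n` the net approximates unit vectors within `1/4`. Replacing both vectors by
net points costs `‖T‖/4` each, so `‖T‖ ≤ B + ‖T‖/2`. -/
theorem matrixSpectralNorm_le_of_latticeNet {n : ℕ} (hn : 0 < n)
    (M : Matrix (Fin n) (Fin n) ℝ) {B : ℝ} (hB : 0 ≤ B)
    (h : ∀ z ∈ latticeNet n, ∀ w ∈ latticeNet n, ∑ i, ((z i : ℝ) / 4) ^ 2 ≤ (n : ℝ) →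
      ∑ i, ((w i : ℝ) / 4) ^ 2 ≤ (n : ℝ) →
      |∑ i, ∑ j, ((z i : ℝ) / 4) * ((w j : ℝ) / 4) * M i j| ≤ B * n) :
    matrixSpectralNorm M ≤ 2 * B := by
  have hn' : (0 : ℝ) < n := by exact_mod_cast hn
  rw [matrixSpectralNorm]
  set T := Matrix.toEuclideanCLM (n := Fin n) (𝕜 := ℝ) M with hT
  have hunit : ∀ x y : EuclideanSpace ℝ (Fin n), ‖x‖ = 1 → ‖y‖ = 1 →
      inner ℝ (T y) x ≤ B + ‖T‖ / 2 := by
    intro x y hx hy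
    obtain ⟨z, hz, hz1, x', hx', hx'1, hxx'⟩ := exists_scaled_latticeNet_near hn x hx
    obtain ⟨w, hw, hw1, y', hy', hy'1, hyy'⟩ := exists_scaled_latticeNet_near hn y hy
    have h1 : inner ℝ (T y') x' ≤ B := by
      have hs : (√(n : ℝ))⁻¹ * (√n)⁻¹ = (n : ℝ)⁻¹ := by
        rw [← mul_inv, Real.mul_self_sqrt hn'.le]
      rw [hT, inner_toEuclideanCLM]
      have h2 : ∑ i, ∑ j, x' i * y' j * M i j =
          (n : ℝ)⁻¹ * ∑ i, ∑ j, ((z i : ℝ) / 4) * ((w j : ℝ) / 4) * M i j := by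
        simp only [Finset.mul_sum, ← hs, hx', hy']
        exact Finset.sum_congr rfl fun i _ => Finset.sum_congr rfl fun j _ => by ring
      rw [h2, inv_mul_le_iff₀ hn', mul_comm]
      exact (le_abs_self _).trans (h z hz w hw hz1 hw1)
    have h2 : inner ℝ (T y) x = inner ℝ (T y') x' + inner ℝ (T (y - y')) x'
        + inner ℝ (T y) (x - x') := by
      rw [map_sub, inner_sub_left, inner_sub_right]; ring
    have h3 : inner ℝ (T (y - y')) x' ≤ ‖T‖ * (1 / 4) := by
      calc _ ≤ ‖T (y - y')‖ * ‖x'‖ := real_inner_le_norm _ _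
        _ ≤ ‖T (y - y')‖ * 1 := by gcongr
        _ ≤ ‖T‖ * ‖y - y'‖ := by rw [mul_one]; exact T.le_opNorm _
        _ ≤ _ := by gcongr
    have h4 : inner ℝ (T y) (x - x') ≤ ‖T‖ * (1 / 4) := by
      calc _ ≤ ‖T y‖ * ‖x - x'‖ := real_inner_le_norm _ _
        _ ≤ (‖T‖ * ‖y‖) * (1 / 4) := by gcongr; exact T.le_opNorm _
        _ = _ := by rw [hy]; ring
    rw [h2]; linarith
  have hnorm : ‖T‖ ≤ B + ‖T‖ / 2 := by
    refine T.opNorm_le_of_unit_norm (by positivity) fun y hy => ?_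
    rcases eq_or_ne (T y) 0 with h0 | h0
    · rw [h0, norm_zero]; positivity
    have hpos : 0 < ‖T y‖ := norm_pos_iff.2 h0
    have := hunit ((‖T y‖)⁻¹ • T y) y (by rw [norm_smul, norm_inv, norm_norm];
                                          exact inv_mul_cancel₀ hpos.ne') hy
    rw [real_inner_smul_right, real_inner_self_eq_norm_sq] at this
    have h5 : ‖T y‖⁻¹ * ‖T y‖ ^ 2 = ‖T y‖ := by field_simp
    linarith
  linarith

/-! ### Dyadic levels -/

/-- The dyadic level of a real number; numbers of modulus less than `2` have level `0`. -/
noncomputable def dyadicLevel (u : ℝ) : ℕ := Nat.log 2 ⌊|u|⌋₊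

theorem abs_lt_two_pow_dyadicLevel (u : ℝ) : |u| < 2 ^ (dyadicLevel u + 1) := by
  have h1 := Nat.lt_pow_succ_log_self one_lt_two ⌊|u|⌋₊
  have h2 := (Nat.floor_lt (abs_nonneg u)).1 h1
  exact_mod_cast h2

theorem two_pow_dyadicLevel_le {u : ℝ} (h : dyadicLevel u ≠ 0) : 2 ^ dyadicLevel u ≤ |u| := by
  have h0 : ⌊|u|⌋₊ ≠ 0 := by
    intro h0
    simp [dyadicLevel, h0] at h
  have h1 := (Nat.le_floor_iff (abs_nonneg u)).1 (Nat.pow_log_le_self 2 h0)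
  exact_mod_cast h1

/-- Level `0` contains arbitrarily small numbers, hence the maximum with `1`. -/
theorem two_pow_dyadicLevel_le_max (u : ℝ) : 2 ^ dyadicLevel u ≤ max |u| 1 := by
  by_cases h : dyadicLevel u = 0
  · simp [h]
  · exact le_max_of_le_left (two_pow_dyadicLevel_le h)

theorem four_pow_dyadicLevel_le_sq {u : ℝ} (h : dyadicLevel u ≠ 0) :
    4 ^ dyadicLevel u ≤ u ^ 2 := by
  calc (4 : ℝ) ^ dyadicLevel u = (2 ^ dyadicLevel u) ^ 2 := by
        rw [← pow_mul, mul_comm, pow_mul]; norm_num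
    _ ≤ |u| ^ 2 := pow_le_pow_left₀ (by positivity) (two_pow_dyadicLevel_le h) 2
    _ = u ^ 2 := sq_abs u

/-! ### Geometric sums weighted by entropies -/

theorem sum_two_pow_div_le {M : ℕ} (hM : 1 ≤ M) :
    ∑ m ∈ Finset.Icc 1 M, (2 : ℝ) ^ m / m ≤ 4 * 2 ^ M / M := by
  induction M, hM using Nat.le_induction with
  | base => norm_num
  | succ M hM ih =>
    rw [Finset.sum_Icc_succ_top (by omega)]
    -- The comparison `4 / M ≤ 6 / (M + 1)` below needs `M ≥ 2`.
    rcases hM.eq_or_lt with rfl | hM2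
    · norm_num
    have hM' : (2 : ℝ) ≤ M := by exact_mod_cast hM2
    have h2 : (0 : ℝ) < 2 ^ M := by positivity
    have h3 : 4 * 2 ^ M / (M : ℝ) ≤ 6 * 2 ^ M / (M + 1) := by
      rw [div_le_div_iff₀ (by linarith) (by linarith)]
      nlinarith
    push_cast
    calc _ ≤ 6 * 2 ^ M / ((M : ℝ) + 1) + 2 ^ (M + 1) / (M + 1) := by linarith
      _ = _ := by rw [← add_div, pow_succ]; ring

/-- A level set with `4^b * B b ≤ n` has entropy of order `b * B b`, and the division by `b` cancels
this factor. -/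
theorem sum_four_pow_div_mul_subsetEntropy_le {n X : ℕ} {B : ℕ → ℕ} (hB : ∀ b, B b ≤ n)
    (hsum : ∑ b ∈ Finset.Icc 1 X, (4 : ℝ) ^ b * B b ≤ n) :
    ∑ b ∈ Finset.Icc 1 X, (4 : ℝ) ^ b / b * subsetEntropy n (B b) ≤ 6 * n := by
  have hterm : ∀ b ∈ Finset.Icc 1 X, (4 : ℝ) ^ b / b * subsetEntropy n (B b) ≤
      4 * (4 ^ b * B b) + n * (1 / 2) ^ b := by
    intro b hb
    have hb1 : (1 : ℝ) ≤ b := by exact_mod_cast (Finset.mem_Icc.1 hb).1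
    -- With `l = 3b`, the factor `1 + l ≤ 4b` is absorbed by `1 / b`, and `exp (-l) ≤ 8^(-b)` beats
    -- `4^b`.
    have h1 := subsetEntropy_le_add (hB b) (3 * b)
    have he : Real.exp (-(3 * (b : ℝ))) ≤ (1 / 8) ^ b := by
      have h2 : (2 : ℝ) ≤ Real.exp 1 := by linarith [Real.add_one_le_exp (1 : ℝ)]
      have h8 : (8 : ℝ) ≤ Real.exp 3 := by
        calc (8 : ℝ) = 2 ^ 3 := by norm_num
          _ ≤ Real.exp 1 ^ 3 := pow_le_pow_left₀ zero_le_two h2 3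
          _ = Real.exp 3 := by rw [← Real.exp_nat_mul]; norm_num
      rw [Real.exp_neg, one_div, inv_pow, mul_comm, Real.exp_nat_mul]
      exact inv_anti₀ (by positivity) (pow_le_pow_left₀ (by norm_num) h8 b)
    have hn0 : (0 : ℝ) ≤ n := Nat.cast_nonneg n
    have hB0 : (0 : ℝ) ≤ B b := Nat.cast_nonneg _
    calc (4 : ℝ) ^ b / b * subsetEntropy n (B b)
        ≤ 4 ^ b / b * (B b * (4 * b) + b * (n * (1 / 8) ^ b)) := by
          refine mul_le_mul_of_nonneg_left (h1.trans (add_le_add ?_ ?_)) (by positivity)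
          · exact mul_le_mul_of_nonneg_left (by linarith) hB0
          · calc (n : ℝ) * Real.exp (-(3 * (b : ℝ))) ≤ n * (1 / 8) ^ b := by gcongr
              _ ≤ _ := le_mul_of_one_le_left (by positivity) hb1
      _ = 4 * (4 ^ b * B b) + n * (4 ^ b * (1 / 8) ^ b) := by field_simp
      _ = _ := by rw [← mul_pow]; norm_num
  have hgeo : ∑ b ∈ Finset.Icc 1 X, (1 / 2 : ℝ) ^ b ≤ 2 := by
    refine (Finset.sum_le_sum_of_subset_of_nonneg (t := Finset.range (X + 1)) ?_
      fun _ _ _ => by positivity).trans (sum_geometric_two_le _)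
    intro b hb
    rw [Finset.mem_Icc] at hb
    rw [Finset.mem_range]
    omega
  refine (Finset.sum_le_sum hterm).trans ?_
  rw [Finset.sum_add_distrib, ← Finset.mul_sum, ← Finset.mul_sum]
  have := mul_le_mul_of_nonneg_left hgeo (Nat.cast_nonneg (α := ℝ) n)
  linarith

/-- The weight of the pair of levels `a`, `b` in units of its exponent `a + b - s`, for heavy pairs
in which `a` is not much larger than `b`. -/
noncomputable def levelWeight (s a b : ℕ) : ℝ :=
  if s < a + b ∧ a ≤ b + s then (2 : ℝ) ^ (a + b) / (a + b - s : ℕ) else 0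

theorem levelWeight_nonneg (s a b : ℕ) : 0 ≤ levelWeight s a b := by
  rw [levelWeight]
  split_ifs <;> positivity

/-- In terms of `m = a + b - s` the terms are `2^s * 2^m / m`, and `a ≤ b + s` means `m ≤ 2b`. The
sum is of the order of its last term. -/
theorem sum_levelWeight_le {s b X : ℕ} (hb : 1 ≤ b) :
    ∑ a ∈ Finset.Icc 1 X, levelWeight s a b ≤ 2 ^ s * (2 * (4 ^ b / b)) := by
  classical
  simp only [levelWeight]
  rw [← Finset.sum_filter]
  have hb' : (0 : ℝ) < b := by exact_mod_cast hb
  calc ∑ a ∈ Finset.Icc 1 X with s < a + b ∧ a ≤ b + s, (2 : ℝ) ^ (a + b) / (a + b - s : ℕ)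
      = ∑ a ∈ Finset.Icc 1 X with s < a + b ∧ a ≤ b + s,
          2 ^ s * ((2 : ℝ) ^ (a + b - s) / (a + b - s : ℕ)) := by
        refine Finset.sum_congr rfl fun a ha => ?_
        rw [Finset.mem_filter] at ha
        rw [← mul_div_assoc, ← pow_add]
        congr 2
        omega
    _ = ∑ m ∈ ((Finset.Icc 1 X).filter fun a => s < a + b ∧ a ≤ b + s).image fun a => a + b - s,
          2 ^ s * ((2 : ℝ) ^ m / m) := by
        rw [Finset.sum_image]
        intro a ha a' ha' h
        simp only [Finset.coe_filter, Set.mem_ofPred_eq] at ha ha' h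
        omega
    _ ≤ ∑ m ∈ Finset.Icc 1 (2 * b), 2 ^ s * ((2 : ℝ) ^ m / m) := by
        refine Finset.sum_le_sum_of_subset_of_nonneg ?_ fun _ _ _ => by positivity
        intro m hm
        simp only [Finset.mem_image, Finset.mem_filter] at hm
        obtain ⟨a, ha, rfl⟩ := hm
        rw [Finset.mem_Icc]
        omega
    _ ≤ 2 ^ s * (4 * 2 ^ (2 * b) / (2 * b : ℕ)) := by
        rw [← Finset.mul_sum]
        exact mul_le_mul_of_nonneg_left (sum_two_pow_div_le (by omega)) (by positivity)
    _ = _ := by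
        rw [pow_mul]
        push_cast
        field_simp
        norm_num

theorem sum_levelWeight_mul_subsetEntropy_le {n s X : ℕ} {B : ℕ → ℕ} (hB : ∀ b, B b ≤ n)
    (hsum : ∑ b ∈ Finset.Icc 1 X, (4 : ℝ) ^ b * B b ≤ n) :
    ∑ b ∈ Finset.Icc 1 X, ∑ a ∈ Finset.Icc 1 X, levelWeight s a b * subsetEntropy n (B b) ≤
      12 * 2 ^ s * n := by
  calc _ ≤ ∑ b ∈ Finset.Icc 1 X, 2 ^ s * (2 * (4 ^ b / b)) * subsetEntropy n (B b) := by
        refine Finset.sum_le_sum fun b hb => ?_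
        rw [← Finset.sum_mul]
        exact mul_le_mul_of_nonneg_right (sum_levelWeight_le (Finset.mem_Icc.1 hb).1)
          (subsetEntropy_nonneg (hB b))
    _ = 2 ^ s * 2 * ∑ b ∈ Finset.Icc 1 X, (4 : ℝ) ^ b / b * subsetEntropy n (B b) := by
        rw [Finset.mul_sum]
        exact Finset.sum_congr rfl fun b _ => by ring
    _ ≤ 2 ^ s * 2 * (6 * n) :=
        mul_le_mul_of_nonneg_left (sum_four_pow_div_mul_subsetEntropy_le hB hsum) (by positivity)
    _ = _ := by ring

/-- Sums the discrepancy errors over all pairs of levels. The main term factorises and gives `2 n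
√D`; each entropy term gives `12 n √D`; and `104 = 4 * (2 + 12 + 12)`. -/
theorem sum_levelWeight_errors_le {n s X : ℕ} {C D : ℝ} (hC : 0 ≤ C) (hD : 0 ≤ D)
    (hs : 2 ^ s ≤ √D) (hs' : √D ≤ 2 * 2 ^ s) {A B : ℕ → ℕ} (hA : ∀ a, A a ≤ n)
    (hB : ∀ b, B b ≤ n) (hAsum : ∑ a ∈ Finset.Icc 1 X, (4 : ℝ) ^ a * A a ≤ n)
    (hBsum : ∑ b ∈ Finset.Icc 1 X, (4 : ℝ) ^ b * B b ≤ n) :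
    ∑ a ∈ Finset.Icc 1 X, ∑ b ∈ Finset.Icc 1 X, 4 * C * (D / n / 2 ^ s *
      ((4 ^ a * A a) * (4 ^ b * B b)) + levelWeight s b a * subsetEntropy n (A a) +
        levelWeight s a b * subsetEntropy n (B b)) ≤ 104 * C * (n * √D) := by
  have hpow : (0 : ℝ) < 2 ^ s := by positivity
  have hEA := sum_levelWeight_mul_subsetEntropy_le (s := s) hA hAsum
  have hEB := sum_levelWeight_mul_subsetEntropy_le (s := s) hB hBsum
  rw [Finset.sum_comm] at hEB
  have hmain : ∑ a ∈ Finset.Icc 1 X, ∑ b ∈ Finset.Icc 1 X, D / n / 2 ^ s *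
      (((4 : ℝ) ^ a * A a) * (4 ^ b * B b)) ≤ 2 * (n * √D) := by
    have h1 : ∑ a ∈ Finset.Icc 1 X, ∑ b ∈ Finset.Icc 1 X, D / n / 2 ^ s *
        (((4 : ℝ) ^ a * A a) * (4 ^ b * B b)) = D / n / 2 ^ s *
          ((∑ a ∈ Finset.Icc 1 X, (4 : ℝ) ^ a * A a) *
            ∑ b ∈ Finset.Icc 1 X, (4 : ℝ) ^ b * B b) := by
      rw [Finset.sum_mul_sum, Finset.mul_sum]
      exact Finset.sum_congr rfl fun a _ => by rw [Finset.mul_sum]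
    rw [h1]
    have hDs : D ≤ √D * (2 * 2 ^ s) := by
      nth_rewrite 1 [← Real.mul_self_sqrt hD]
      exact mul_le_mul_of_nonneg_left hs' (Real.sqrt_nonneg D)
    calc _ ≤ D / n / 2 ^ s * ((n : ℝ) * n) := by
          refine mul_le_mul_of_nonneg_left ?_ (by positivity)
          exact mul_le_mul hAsum hBsum
            (Finset.sum_nonneg fun _ _ => by positivity) (Nat.cast_nonneg n)
      _ ≤ D / 2 ^ s * n := by
          rcases Nat.eq_zero_or_pos n with rfl | hn
          · simp
          · have hn' : (0 : ℝ) < n := by exact_mod_cast hn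
            exact le_of_eq (by field_simp)
      _ ≤ 2 * √D * n := by
          refine mul_le_mul_of_nonneg_right ?_ (Nat.cast_nonneg n)
          rw [div_le_iff₀ hpow]
          linarith
      _ = _ := by ring
  calc _ = 4 * C * (∑ a ∈ Finset.Icc 1 X, ∑ b ∈ Finset.Icc 1 X, D / n / 2 ^ s *
        ((4 ^ a * A a) * (4 ^ b * B b)) +
        ∑ a ∈ Finset.Icc 1 X, ∑ b ∈ Finset.Icc 1 X, levelWeight s b a * subsetEntropy n (A a) +
        ∑ a ∈ Finset.Icc 1 X, ∑ b ∈ Finset.Icc 1 X,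
          levelWeight s a b * subsetEntropy n (B b)) := by
        rw [← Finset.sum_add_distrib, ← Finset.sum_add_distrib, Finset.mul_sum]
        refine Finset.sum_congr rfl fun a _ => ?_
        rw [← Finset.mul_sum, Finset.sum_add_distrib, Finset.sum_add_distrib]
    _ ≤ 4 * C * (2 * (n * √D) + 12 * 2 ^ s * n + 12 * 2 ^ s * n) := by
        refine mul_le_mul_of_nonneg_left (add_le_add (add_le_add hmain hEA) hEB) (by positivity)
    _ ≤ 4 * C * (2 * (n * √D) + 12 * √D * n + 12 * √D * n) := by gcongr
    _ = _ := by ring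

/-! ### The contribution of the heavy pairs -/

/-- The total weight of each combinatorial rectangle is controlled by its expected weight, with an
error given by the entropies of its sides; `m` is the logarithm of the allowed excess. -/
def HasBoundedDiscrepancy {n : ℕ} (C D : ℝ) (A : Matrix (Fin n) (Fin n) ℝ) : Prop :=
  ∀ I J : Finset (Fin n), I.Nonempty → J.Nonempty → ∀ m ∈ Finset.Icc 1 n,
    (m : ℝ) * ∑ i ∈ I, ∑ j ∈ J, A i j ≤
      C * (2 ^ m * (D / n) * (I.card * J.card) + subsetEntropy n I.card + subsetEntropy n J.card)

theorem sum_sum_eq_sum_levels {ι : Type*} [Fintype ι] (a b : ι → ℕ) (F : ℕ → ℕ → ℝ)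
    (A : ι → ι → ℝ) (T : Finset ℕ) (h : ∀ i j, F (a i) (b j) ≠ 0 → a i ∈ T ∧ b j ∈ T) :
    ∑ i, ∑ j, F (a i) (b j) * A i j =
      ∑ x ∈ T, ∑ y ∈ T, F x y * ∑ i with a i = x, ∑ j with b j = y, A i j := by
  have h1 : ∀ i j, F (a i) (b j) * A i j =
      ∑ x ∈ T, ∑ y ∈ T, if a i = x then if b j = y then F x y * A i j else 0 else 0 := by
    intro i j
    by_cases hF : F (a i) (b j) = 0
    · rw [hF, zero_mul]
      symm
      refine Finset.sum_eq_zero fun x _ => Finset.sum_eq_zero fun y _ => ?_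
      split_ifs with hx hy
      · rw [← hx, ← hy, hF, zero_mul]
      · rfl
      · rfl
    · obtain ⟨hx, hy⟩ := h i j hF
      rw [Finset.sum_eq_single (a i), Finset.sum_eq_single (b j)]
      · simp
      · intro y _ hne; simp [hne.symm]
      · exact fun h => absurd hy h
      · intro x _ hne; simp [hne.symm]
      · exact fun h => absurd hx h
  simp only [h1]
  calc _ = ∑ i, ∑ x ∈ T, ∑ y ∈ T, ∑ j,
        (if a i = x then if b j = y then F x y * A i j else 0 else 0) := by
        refine Finset.sum_congr rfl fun i _ => ?_
        rw [Finset.sum_comm]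
        exact Finset.sum_congr rfl fun x _ => Finset.sum_comm
    _ = ∑ x ∈ T, ∑ y ∈ T, ∑ i, ∑ j,
        (if a i = x then if b j = y then F x y * A i j else 0 else 0) := by
        rw [Finset.sum_comm]
        exact Finset.sum_congr rfl fun x _ => Finset.sum_comm
    _ = _ := by
        refine Finset.sum_congr rfl fun x _ => Finset.sum_congr rfl fun y _ => ?_
        rw [Finset.mul_sum, Finset.sum_filter]
        refine Finset.sum_congr rfl fun i _ => ?_
        by_cases hx : a i = x
        · simp only [hx, if_true]
          rw [Finset.mul_sum, Finset.sum_filter]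
        · simp [hx]

theorem sum_four_pow_mul_card_level_le {n : ℕ} (u : Fin n → ℝ) (hu : ∑ i, u i ^ 2 ≤ n) (X : ℕ) :
    ∑ a ∈ Finset.Icc 1 X, (4 : ℝ) ^ a *
      (Finset.univ.filter fun i => dyadicLevel (u i) = a).card ≤ n := by
  refine le_trans ?_ hu
  calc _ = ∑ i, ∑ a ∈ Finset.Icc 1 X, if dyadicLevel (u i) = a then (4 : ℝ) ^ a else 0 := by
        rw [Finset.sum_comm]
        refine Finset.sum_congr rfl fun a _ => ?_
        rw [Finset.card_filter, Nat.cast_sum, Finset.mul_sum]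
        refine Finset.sum_congr rfl fun i _ => ?_
        split_ifs <;> simp
    _ ≤ _ := by
        refine Finset.sum_le_sum fun i _ => ?_
        rw [Finset.sum_ite_eq]
        split_ifs with h
        · exact four_pow_dyadicLevel_le_sq (by have := (Finset.mem_Icc.1 h).1; omega)
        · positivity

theorem four_pow_dyadicLevel_le_card {n : ℕ} {u : Fin n → ℝ} (hu : ∑ i, u i ^ 2 ≤ n) {i : Fin n}
    (h : dyadicLevel (u i) ≠ 0) : 4 ^ dyadicLevel (u i) ≤ n := by
  have h1 := four_pow_dyadicLevel_le_sq h
  have h2 := Finset.single_le_sum (f := fun i => u i ^ 2) (fun _ _ => sq_nonneg _)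
    (Finset.mem_univ i)
  exact_mod_cast (h1.trans h2).trans hu

theorem rectangle_weight_le {n s : ℕ} {C D : ℝ} (hC : 0 ≤ C) (hD : 0 ≤ D)
    {A : Matrix (Fin n) (Fin n) ℝ} (hdisc : HasBoundedDiscrepancy C D A) {u v : Fin n → ℝ}
    (hu : ∑ i, u i ^ 2 ≤ n) (hv : ∑ i, v i ^ 2 ≤ n) {a b : ℕ} (ha : 1 ≤ a) (hb : 1 ≤ b)
    (hs : s < a + b) {I J : Finset (Fin n)} (hI : ∀ i ∈ I, dyadicLevel (u i) = a)
    (hJ : ∀ j ∈ J, dyadicLevel (v j) = b) :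
    ∑ i ∈ I, ∑ j ∈ J, A i j ≤ C / (a + b - s : ℕ) * (2 ^ (a + b - s) * (D / n) *
      (I.card * J.card) + subsetEntropy n I.card + subsetEntropy n J.card) := by
  have hIn : I.card ≤ n := by simpa using I.card_le_univ
  have hJn : J.card ≤ n := by simpa using J.card_le_univ
  have h1 := subsetEntropy_nonneg hIn
  have h2 := subsetEntropy_nonneg hJn
  rcases I.eq_empty_or_nonempty with rfl | hI'
  · simp only [Finset.sum_empty]; positivity
  rcases J.eq_empty_or_nonempty with rfl | hJ'
  · simp only [Finset.sum_empty, Finset.sum_const_zero]; positivity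
  obtain ⟨i, hi⟩ := hI'
  obtain ⟨j, hj⟩ := hJ'
  have ha4 : 4 ^ a ≤ n := by
    have := four_pow_dyadicLevel_le_card hu (i := i) (by rw [hI i hi]; omega)
    rwa [hI i hi] at this
  have hb4 : 4 ^ b ≤ n := by
    have := four_pow_dyadicLevel_le_card hv (i := j) (by rw [hJ j hj]; omega)
    rwa [hJ j hj] at this
  -- A single coordinate of level `a` already forces `4^a ≤ n`, so the exponents `m ≤ n` in
  -- `HasBoundedDiscrepancy` suffice.
  have hab : a + b ≤ n := by
    have h3 : (2 ^ (a + b)) ^ 2 ≤ n ^ 2 := by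
      calc (2 ^ (a + b)) ^ 2 = 4 ^ a * 4 ^ b := by
            rw [← pow_mul, mul_comm, pow_mul, pow_add]; norm_num
        _ ≤ n * n := Nat.mul_le_mul ha4 hb4
        _ = n ^ 2 := (sq n).symm
    exact Nat.lt_two_pow_self.le.trans ((Nat.pow_le_pow_iff_left two_ne_zero).1 h3)
  have h4 := hdisc I J ⟨i, hi⟩ ⟨j, hj⟩ (a + b - s) (Finset.mem_Icc.2 ⟨by omega, by omega⟩)
  have hm : (0 : ℝ) < (a + b - s : ℕ) := by
    have : 0 < a + b - s := by omega
    exact_mod_cast this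
  rw [div_mul_eq_mul_div, le_div_iff₀ hm, mul_comm]
  exact h4

/-- Each pair of level sets is a rectangle, to which discrepancy applies with `m = a + b - s`. The
balance conditions let the weight of each entropy be summed over the other level. -/
theorem balanced_heavy_sum_le {n s : ℕ} {C D : ℝ} (hC : 0 ≤ C) (hD : 0 ≤ D)
    (hs : 2 ^ s ≤ √D) (hs' : √D ≤ 2 * 2 ^ s)
    {A : Matrix (Fin n) (Fin n) ℝ} (hA : ∀ i j, 0 ≤ A i j)
    (hdisc : HasBoundedDiscrepancy C D A) {u v : Fin n → ℝ}
    (hu : ∑ i, u i ^ 2 ≤ n) (hv : ∑ i, v i ^ 2 ≤ n) :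
    ∑ i, ∑ j, (if s < dyadicLevel (u i) + dyadicLevel (v j) ∧
        dyadicLevel (u i) ≤ dyadicLevel (v j) + s ∧ dyadicLevel (v j) ≤ dyadicLevel (u i) + s
      then |u i| * |v j| * A i j else 0) ≤ 104 * C * (n * √D) := by
  classical
  set F : ℕ → ℕ → ℝ := fun a b =>
    if s < a + b ∧ a ≤ b + s ∧ b ≤ a + s then 4 * 2 ^ (a + b) else 0 with hF
  set I : ℕ → Finset (Fin n) := fun a => Finset.univ.filter fun i => dyadicLevel (u i) = a with hI
  set J : ℕ → Finset (Fin n) := fun b => Finset.univ.filter fun i => dyadicLevel (v i) = b with hJ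
  have hcard : ∀ S : Finset (Fin n), S.card ≤ n := fun S => by simpa using S.card_le_univ
  have hIsum := sum_four_pow_mul_card_level_le u hu n
  have hJsum := sum_four_pow_mul_card_level_le v hv n
  have hpow : (0 : ℝ) < 2 ^ s := by positivity
  have hlev : ∀ {w : Fin n → ℝ}, ∑ i, w i ^ 2 ≤ (n : ℝ) → ∀ i, dyadicLevel (w i) ≠ 0 →
      dyadicLevel (w i) ∈ Finset.Icc 1 n := by
    intro w hw i h
    have h1 := four_pow_dyadicLevel_le_card hw h
    have h2 : dyadicLevel (w i) < 4 ^ dyadicLevel (w i) := Nat.lt_pow_self (by norm_num)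
    rw [Finset.mem_Icc]
    omega
  have step1 : ∑ i, ∑ j, (if s < dyadicLevel (u i) + dyadicLevel (v j) ∧
        dyadicLevel (u i) ≤ dyadicLevel (v j) + s ∧ dyadicLevel (v j) ≤ dyadicLevel (u i) + s
      then |u i| * |v j| * A i j else 0) ≤
      ∑ i, ∑ j, F (dyadicLevel (u i)) (dyadicLevel (v j)) * A i j := by
    refine Finset.sum_le_sum fun i _ => Finset.sum_le_sum fun j _ => ?_
    simp only [hF]
    split_ifs with h
    · refine mul_le_mul_of_nonneg_right ?_ (hA i j)
      calc |u i| * |v j| ≤ 2 ^ (dyadicLevel (u i) + 1) * 2 ^ (dyadicLevel (v j) + 1) :=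
            mul_le_mul (abs_lt_two_pow_dyadicLevel _).le (abs_lt_two_pow_dyadicLevel _).le
              (abs_nonneg _) (by positivity)
        _ = _ := by rw [pow_succ, pow_succ, pow_add]; ring
    · simp
  have step2 : ∑ i, ∑ j, F (dyadicLevel (u i)) (dyadicLevel (v j)) * A i j =
      ∑ a ∈ Finset.Icc 1 n, ∑ b ∈ Finset.Icc 1 n, F a b * ∑ i ∈ I a, ∑ j ∈ J b, A i j := by
    refine sum_sum_eq_sum_levels _ _ F A (Finset.Icc 1 n) fun i j h => ?_
    have hc : s < dyadicLevel (u i) + dyadicLevel (v j) ∧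
        dyadicLevel (u i) ≤ dyadicLevel (v j) + s ∧ dyadicLevel (v j) ≤ dyadicLevel (u i) + s := by
      by_contra hc
      exact h (if_neg hc)
    -- Heavy and balanced together exclude level `0`: if `a = 0`, then `b ≤ s < a + b` is
    -- impossible.
    exact ⟨hlev hu i (by omega), hlev hv j (by omega)⟩
  have step3 : ∀ a ∈ Finset.Icc 1 n, ∀ b ∈ Finset.Icc 1 n,
      F a b * ∑ i ∈ I a, ∑ j ∈ J b, A i j ≤ 4 * C * (D / n / 2 ^ s *
        ((4 ^ a * (I a).card) * (4 ^ b * (J b).card)) + levelWeight s b a * subsetEntropy n (I a).card +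
          levelWeight s a b * subsetEntropy n (J b).card) := by
    intro a ha b hb
    have hHI := subsetEntropy_nonneg (hcard (I a))
    have hHJ := subsetEntropy_nonneg (hcard (J b))
    by_cases hc : s < a + b ∧ a ≤ b + s ∧ b ≤ a + s
    · have hFab : F a b = 4 * 2 ^ (a + b) := if_pos hc
      have hGab : levelWeight s a b = (2 : ℝ) ^ (a + b) / (a + b - s : ℕ) := if_pos ⟨hc.1, hc.2.1⟩
      have hGba : levelWeight s b a = (2 : ℝ) ^ (a + b) / (a + b - s : ℕ) := by
        rw [add_comm a b]; exact if_pos ⟨by omega, hc.2.2⟩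
      have h1 := rectangle_weight_le (s := s) hC hD hdisc hu hv (Finset.mem_Icc.1 ha).1
        (Finset.mem_Icc.1 hb).1 hc.1 (I := I a) (J := J b)
        (fun i hi => (Finset.mem_filter.1 hi).2) (fun j hj => (Finset.mem_filter.1 hj).2)
      have hm : (1 : ℝ) ≤ (a + b - s : ℕ) := by
        have : 1 ≤ a + b - s := by omega
        exact_mod_cast this
      have hm0 : (0 : ℝ) < (a + b - s : ℕ) := by linarith
      have h2 : (2 : ℝ) ^ (a + b) / (a + b - s : ℕ) * (2 ^ (a + b - s) * (D / n) *
          ((I a).card * (J b).card)) ≤ D / n / 2 ^ s *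
            ((4 ^ a * (I a).card) * (4 ^ b * (J b).card)) := by
        have h3 : (2 : ℝ) ^ (a + b - s) = 2 ^ (a + b) / 2 ^ s := by
          rw [eq_div_iff hpow.ne', ← pow_add]
          congr 1
          omega
        have h4 : (2 : ℝ) ^ (a + b) * 2 ^ (a + b) = 4 ^ a * 4 ^ b := by
          rw [← mul_pow, ← pow_add]; norm_num
        calc _ ≤ (2 : ℝ) ^ (a + b) * (2 ^ (a + b - s) * (D / n) * ((I a).card * (J b).card)) := by
              refine mul_le_mul_of_nonneg_right (div_le_self (by positivity) hm) (by positivity)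
          _ = D / n / 2 ^ s * ((2 ^ (a + b) * 2 ^ (a + b)) * ((I a).card * (J b).card)) := by
              rw [h3]; ring
          _ = _ := by rw [h4]; ring
      rw [hFab, hGab, hGba]
      calc _ ≤ 4 * 2 ^ (a + b) * (C / (a + b - s : ℕ) * (2 ^ (a + b - s) * (D / n) *
            ((I a).card * (J b).card) + subsetEntropy n (I a).card +
              subsetEntropy n (J b).card)) :=
            mul_le_mul_of_nonneg_left h1 (by positivity)
        _ = 4 * C * ((2 : ℝ) ^ (a + b) / (a + b - s : ℕ) * (2 ^ (a + b - s) * (D / n) *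
          ((I a).card * (J b).card)) + (2 : ℝ) ^ (a + b) / (a + b - s : ℕ) *
            subsetEntropy n (I a).card + (2 : ℝ) ^ (a + b) / (a + b - s : ℕ) *
              subsetEntropy n (J b).card) := by ring
        _ ≤ _ := by gcongr
    · rw [show F a b = 0 from if_neg hc, zero_mul]
      have := levelWeight_nonneg s a b
      have := levelWeight_nonneg s b a
      positivity
  refine le_trans ?_ (sum_levelWeight_errors_le hC hD hs hs' (fun a => hcard (I a))
    (fun b => hcard (J b)) hIsum hJsum)
  rw [step2] at step1
  exact step1.trans (Finset.sum_le_sum fun a ha => Finset.sum_le_sum fun b hb =>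
    step3 a ha b hb)

/-- Here `|v j| * 2^s ≤ |u i|`, so `|u i| * |v j|` is at most `u i ^ 2 / 2^s`, which no longer
depends on `j`; the row sums finish. -/
theorem unbalanced_heavy_sum_le {n s : ℕ} {L D : ℝ} (hL : 0 ≤ L) (hD : 0 ≤ D)
    (hs' : √D ≤ 2 * 2 ^ s) {A : Matrix (Fin n) (Fin n) ℝ} (hA : ∀ i j, 0 ≤ A i j)
    (hrow : ∀ i, ∑ j, A i j ≤ L * D) {u v : Fin n → ℝ} (hu : ∑ i, u i ^ 2 ≤ n) :
    ∑ i, ∑ j, (if dyadicLevel (v j) + s < dyadicLevel (u i) then |u i| * |v j| * A i j else 0)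
      ≤ 2 * L * (n * √D) := by
  have hpow : (0 : ℝ) < 2 ^ s := by positivity
  have hDs : D / 2 ^ s ≤ 2 * √D := by
    rw [div_le_iff₀ hpow]
    nth_rewrite 1 [← Real.mul_self_sqrt hD]
    nlinarith [Real.sqrt_nonneg D]
  calc _ ≤ ∑ i, ∑ j, u i ^ 2 / 2 ^ s * A i j := by
        refine Finset.sum_le_sum fun i _ => Finset.sum_le_sum fun j _ => ?_
        split_ifs with h
        · refine mul_le_mul_of_nonneg_right ?_ (hA i j)
          rw [le_div_iff₀ hpow]
          have h1 : |v j| * 2 ^ s ≤ |u i| := by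
            calc |v j| * 2 ^ s ≤ 2 ^ (dyadicLevel (v j) + 1) * 2 ^ s := by
                  gcongr
                  exact (abs_lt_two_pow_dyadicLevel _).le
              _ = 2 ^ (dyadicLevel (v j) + 1 + s) := (pow_add _ _ _).symm
              _ ≤ 2 ^ dyadicLevel (u i) := pow_le_pow_right₀ one_le_two (by omega)
              _ ≤ |u i| := two_pow_dyadicLevel_le (by omega)
          calc |u i| * |v j| * 2 ^ s = |u i| * (|v j| * 2 ^ s) := by ring
            _ ≤ |u i| * |u i| := mul_le_mul_of_nonneg_left h1 (abs_nonneg _)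
            _ = u i ^ 2 := by rw [← sq, sq_abs]
        · exact mul_nonneg (by positivity) (hA i j)
    _ ≤ ∑ i, u i ^ 2 / 2 ^ s * (L * D) := by
        refine Finset.sum_le_sum fun i _ => ?_
        rw [← Finset.mul_sum]
        exact mul_le_mul_of_nonneg_left (hrow i) (by positivity)
    _ = (D / 2 ^ s) * L * ∑ i, u i ^ 2 := by
        rw [Finset.mul_sum]
        exact Finset.sum_congr rfl fun i _ => by ring
    _ ≤ 2 * √D * L * n := by gcongr
    _ = _ := by ring

/-- In a nonnegative matrix with bounded row sums, column sums and discrepancy, the pairs whose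
dyadic levels add up to more than `s` contribute little to the bilinear form. -/
theorem heavy_sum_le {n s : ℕ} {C L D : ℝ} (hC : 0 ≤ C) (hL : 0 ≤ L) (hD : 0 ≤ D)
    (hs : 2 ^ s ≤ √D) (hs' : √D ≤ 2 * 2 ^ s)
    {A : Matrix (Fin n) (Fin n) ℝ} (hA : ∀ i j, 0 ≤ A i j)
    (hrow : ∀ i, ∑ j, A i j ≤ L * D) (hcol : ∀ j, ∑ i, A i j ≤ L * D)
    (hdisc : HasBoundedDiscrepancy C D A) {u v : Fin n → ℝ}
    (hu : ∑ i, u i ^ 2 ≤ n) (hv : ∑ i, v i ^ 2 ≤ n) :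
    ∑ i, ∑ j, (if dyadicLevel (u i) + dyadicLevel (v j) ≤ s then 0 else |u i| * |v j| * A i j)
      ≤ (4 * L + 104 * C) * (n * √D) := by
  have h1 := unbalanced_heavy_sum_le hL hD hs' hA hrow (v := v) hu
  have h2 := unbalanced_heavy_sum_le (A := A.transpose) hL hD hs' (fun i j => hA j i) hcol
    (v := u) hv
  rw [Finset.sum_comm] at h2
  have h3 := balanced_heavy_sum_le hC hD hs hs' hA hdisc hu hv
  have h4 : ∑ i, ∑ j, (if dyadicLevel (u i) + dyadicLevel (v j) ≤ s then 0
      else |u i| * |v j| * A i j) ≤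
      ∑ i, ∑ j, ((if dyadicLevel (v j) + s < dyadicLevel (u i)
        then |u i| * |v j| * A i j else 0) +
      (if dyadicLevel (u i) + s < dyadicLevel (v j)
        then |v j| * |u i| * A.transpose j i else 0) +
      (if s < dyadicLevel (u i) + dyadicLevel (v j) ∧
        dyadicLevel (u i) ≤ dyadicLevel (v j) + s ∧ dyadicLevel (v j) ≤ dyadicLevel (u i) + s
      then |u i| * |v j| * A i j else 0)) := by
    refine Finset.sum_le_sum fun i _ => Finset.sum_le_sum fun j _ => ?_
    have h0 : 0 ≤ |u i| * |v j| * A i j := mul_nonneg (by positivity) (hA i j)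
    rw [Matrix.transpose_apply, mul_comm |v j|]
    split_ifs <;> first | omega | linarith
  simp only [Finset.sum_add_distrib] at h4
  linarith

/-! ### Sums over the pairs of nodes of a hyperedge -/

/-- The sum of `g` over the ordered pairs of distinct nodes of a hyperedge. -/
def edgeSum {n d : ℕ} (g : Fin n → Fin n → ℝ) (e : HEdge n d) : ℝ :=
  ∑ x ∈ e.1.offDiag, g x.1 x.2

theorem similarityMatrix_eq_sum_offDiag {n d : ℕ} (w : HEdge n d → ℝ) (i j : Fin n) :
    similarityMatrix w i j = ∑ e : HEdge n d, if (i, j) ∈ e.1.offDiag then w e else 0 := by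
  rw [similarityMatrix, Matrix.of_apply]
  split_ifs with h
  · simp [h]
  · refine Finset.sum_congr rfl fun e _ => ?_
    simp [h]

theorem sum_mul_similarityMatrix {n d : ℕ} (g : Fin n → Fin n → ℝ) (w : HEdge n d → ℝ) :
    ∑ i, ∑ j, g i j * similarityMatrix w i j = ∑ e, edgeSum g e * w e := by
  simp only [similarityMatrix_eq_sum_offDiag, edgeSum, Finset.mul_sum]
  rw [← Fintype.sum_prod_type' (f := fun i j => ∑ e : HEdge n d,
    g i j * if (i, j) ∈ e.1.offDiag then w e else 0), Finset.sum_comm]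
  refine Finset.sum_congr rfl fun e _ => ?_
  simp only [mul_ite, mul_zero]
  rw [Finset.sum_ite_mem, Finset.univ_inter, Finset.sum_mul]

/-- Erasing `i` and `j` is injective on the edges that contain both. -/
theorem card_edges_containing_le {n d : ℕ} {i j : Fin n} (hij : i ≠ j) :
    (Finset.univ.filter fun e : HEdge n d => i ∈ e.1 ∧ j ∈ e.1).card ≤ (n - 2).choose (d - 2) := by
  classical
  have hcard : (((Finset.univ : Finset (Fin n)).erase i).erase j).card = n - 2 := by
    rw [Finset.card_erase_of_mem (by simp [hij.symm]), Finset.card_erase_of_mem (by simp)]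
    simp only [Finset.card_univ, Fintype.card_fin]
    omega
  rw [← hcard, ← Finset.card_powersetCard]
  refine Finset.card_le_card_of_injOn (fun e => (e.1.erase i).erase j) ?_ ?_
  · intro e he
    simp only [Finset.coe_filter, Finset.mem_univ, true_and, Set.mem_ofPred_eq] at he
    rw [Finset.mem_coe, Finset.mem_powersetCard]
    refine ⟨Finset.erase_subset_erase _ (Finset.erase_subset_erase _ (Finset.subset_univ _)), ?_⟩
    rw [Finset.card_erase_of_mem (by simp [hij.symm, he.2]), Finset.card_erase_of_mem he.1, e.2]
    omega
  · intro e he e' he' h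
    simp only [Finset.coe_filter, Finset.mem_univ, true_and, Set.mem_ofPred_eq] at he he'
    have h1 : insert i (insert j ((e.1.erase i).erase j)) =
        insert i (insert j ((e'.1.erase i).erase j)) := congrArg _ (congrArg _ h)
    rw [Finset.insert_erase (by simp [hij.symm, he.2]), Finset.insert_erase he.1,
      Finset.insert_erase (by simp [hij.symm, he'.2]), Finset.insert_erase he'.1] at h1
    exact Subtype.ext h1

theorem similarityMatrix_nonneg {n d : ℕ} {w : HEdge n d → ℝ} (hw : ∀ e, 0 ≤ w e) (i j : Fin n) :
    0 ≤ similarityMatrix w i j := by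
  rw [similarityMatrix_eq_sum_offDiag]
  refine Finset.sum_nonneg fun e _ => ?_
  split_ifs
  exacts [hw e, le_rfl]

theorem similarityMatrix_le {n d : ℕ} {w : HEdge n d → ℝ} {t : ℝ} (ht : 0 ≤ t)
    (hw : ∀ e, w e ≤ t) (i j : Fin n) :
    similarityMatrix w i j ≤ (n - 2).choose (d - 2) * t := by
  rw [similarityMatrix, Matrix.of_apply]
  split_ifs with h
  · positivity
  · calc _ ≤ ∑ e : HEdge n d, if i ∈ e.1 ∧ j ∈ e.1 then t else 0 := by
          refine Finset.sum_le_sum fun e _ => ?_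
          split_ifs
          exacts [hw e, le_rfl]
      _ = (Finset.univ.filter fun e : HEdge n d => i ∈ e.1 ∧ j ∈ e.1).card * t := by
          rw [← Finset.sum_filter, Finset.sum_const, nsmul_eq_mul]
      _ ≤ _ := mul_le_mul_of_nonneg_right (by exact_mod_cast card_edges_containing_le h) ht

theorem sum_edgeSum_le {n : ℕ} (d : ℕ) {g : Fin n → Fin n → ℝ} (hg : ∀ i j, 0 ≤ g i j) :
    ∑ e : HEdge n d, edgeSum g e ≤ (n - 2).choose (d - 2) * ∑ i, ∑ j, g i j := by
  have h := sum_mul_similarityMatrix g (fun _ : HEdge n d => 1)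
  simp only [mul_one] at h
  rw [← h, Finset.mul_sum]
  refine Finset.sum_le_sum fun i _ => ?_
  rw [Finset.mul_sum]
  refine Finset.sum_le_sum fun j _ => ?_
  rw [mul_comm]
  refine mul_le_mul_of_nonneg_right ?_ (hg i j)
  simpa using similarityMatrix_le (w := fun _ : HEdge n d => 1) zero_le_one (fun _ => le_rfl) i j

theorem card_offDiag_edge_le {n d : ℕ} (e : HEdge n d) : (e.1.offDiag.card : ℝ) ≤ d ^ 2 := by
  rw [Finset.offDiag_card, e.2, sq]
  exact_mod_cast Nat.sub_le _ _

theorem edgeSum_nonneg {n d : ℕ} {g : Fin n → Fin n → ℝ} (hg : ∀ i j, 0 ≤ g i j)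
    (e : HEdge n d) : 0 ≤ edgeSum g e := Finset.sum_nonneg fun x _ => hg x.1 x.2

theorem abs_edgeSum_le {n d : ℕ} {g : Fin n → Fin n → ℝ} {M : ℝ} (hM : 0 ≤ M)
    (hg : ∀ i j, |g i j| ≤ M) (e : HEdge n d) : |edgeSum g e| ≤ d ^ 2 * M := by
  calc |edgeSum g e| ≤ ∑ x ∈ e.1.offDiag, |g x.1 x.2| := Finset.abs_sum_le_sum_abs _ _
    _ ≤ ∑ _x ∈ e.1.offDiag, M := Finset.sum_le_sum fun x _ => hg x.1 x.2
    _ = e.1.offDiag.card * M := by rw [Finset.sum_const, nsmul_eq_mul]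
    _ ≤ _ := mul_le_mul_of_nonneg_right (card_offDiag_edge_le e) hM

theorem edgeSum_sq_le {n d : ℕ} (g : Fin n → Fin n → ℝ) (e : HEdge n d) :
    edgeSum g e ^ 2 ≤ d ^ 2 * edgeSum (fun i j => g i j ^ 2) e :=
  (sq_sum_le_card_mul_sum_sq).trans
    (mul_le_mul_of_nonneg_right (card_offDiag_edge_le e) (Finset.sum_nonneg fun _ _ => sq_nonneg _))

/-! ### The discrepancy of the random similarity matrix -/

/-- Chernoff with slope `m * log 2` times the share of the at most `d²` ordered node pairs of the
edge that lie in `I × J`. -/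
theorem measure_rectangle_excess_le {Ω : Type*} [MeasurableSpace Ω] {μ : Measure Ω}
    [IsProbabilityMeasure μ] {n d : ℕ} (hd : 2 ≤ d) {W : HEdge n d → Ω → ℝ}
    (hW : ∀ e, Measurable (W e)) (h01 : ∀ e ω, W e ω ∈ Set.Icc (0 : ℝ) 1)
    (hind : iIndepFun W μ) {t : ℝ} (ht : 0 ≤ t) (hmean : ∀ e, ∫ ω, W e ω ∂μ ≤ t) (hn : 0 < n)
    (I J : Finset (Fin n)) (m : ℕ) :
    μ.real {ω | 6 * d ^ 2 * (2 ^ m * (n * (n - 2).choose (d - 2) * t / n) * (I.card * J.card) +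
        subsetEntropy n I.card + subsetEntropy n J.card) <
        m * ∑ i ∈ I, ∑ j ∈ J, similarityMatrix (fun e => W e ω) i j} ≤
      Real.exp (-(3 * subsetEntropy n I.card)) * Real.exp (-(3 * subsetEntropy n J.card)) := by
  classical
  have hn' : (0 : ℝ) < n := by exact_mod_cast hn
  have hd1 : (1 : ℝ) ≤ (d : ℝ) ^ 2 := by
    have : (1 : ℝ) ≤ d := by exact_mod_cast (by omega : 1 ≤ d)
    nlinarith
  have hd0 : (0 : ℝ) < (d : ℝ) ^ 2 := by linarith
  have hHI := subsetEntropy_nonneg (n := n) (by simpa using I.card_le_univ)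
  have hHJ := subsetEntropy_nonneg (n := n) (by simpa using J.card_le_univ)
  set g : Fin n → Fin n → ℝ := fun i j => if i ∈ I then if j ∈ J then 1 else 0 else 0 with hg
  have hg0 : ∀ i j, 0 ≤ g i j := by intro i j; simp only [hg]; split_ifs <;> simp
  have hg1 : ∀ i j, |g i j| ≤ 1 := by intro i j; simp only [hg]; split_ifs <;> simp
  have hgsum : ∀ f : Fin n → Fin n → ℝ,
      ∑ i, ∑ j, g i j * f i j = ∑ i ∈ I, ∑ j ∈ J, f i j := by
    intro f
    rw [← Finset.sum_filter_add_sum_filter_not Finset.univ (fun i => i ∈ I)]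
    rw [Finset.sum_eq_zero (s := Finset.univ.filter fun i => i ∉ I), add_zero]
    · refine Finset.sum_congr (by simp) fun i hi => ?_
      simp [hg, hi]
    · intro i hi
      simp [hg, (Finset.mem_filter.1 hi).2]
  have hgcard : ∑ i, ∑ j, g i j = (I.card : ℝ) * J.card := by
    have := hgsum fun _ _ => 1
    simpa using this
  set b : HEdge n d → ℝ := fun e => m * Real.log 2 * (edgeSum g e / d ^ 2) with hb
  have hx : ∀ e : HEdge n d, edgeSum g e / d ^ 2 ∈ Set.Icc (0 : ℝ) 1 := by
    intro e
    refine ⟨div_nonneg (edgeSum_nonneg hg0 e) hd0.le, (div_le_one hd0).2 ?_⟩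
    simpa using (le_abs_self _).trans (abs_edgeSum_le zero_le_one hg1 e)
  -- The chord of `x ↦ 2^(m x)` on `[0, 1]`.
  have hexp : ∀ e, Real.exp (b e) - 1 ≤ edgeSum g e / d ^ 2 * 2 ^ m := by
    intro e
    have h1 := exp_mul_le_chord (m * Real.log 2) (hx e)
    rw [Real.exp_nat_mul, Real.exp_log two_pos] at h1
    have h2 := (hx e).1
    linarith
  have hb0 : ∀ e, 0 ≤ b e := fun e =>
    mul_nonneg (mul_nonneg (Nat.cast_nonneg m) (Real.log_nonneg one_le_two)) (hx e).1
  have hmean0 : ∀ e, 0 ≤ ∫ ω, W e ω ∂μ := fun e => integral_nonneg fun ω => (h01 e ω).1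
  have hvar : ∑ e, (∫ ω, W e ω ∂μ) * (Real.exp (b e) - 1) ≤
      2 ^ m * (n * (n - 2).choose (d - 2) * t / n) * (I.card * J.card) := by
    calc _ ≤ ∑ e, t * (edgeSum g e / d ^ 2 * 2 ^ m) := by
          refine Finset.sum_le_sum fun e _ => mul_le_mul (hmean e) (hexp e) ?_ ht
          linarith [Real.add_one_le_exp (b e), hb0 e]
      _ = t * 2 ^ m / d ^ 2 * ∑ e : HEdge n d, edgeSum g e := by
          rw [Finset.mul_sum]
          exact Finset.sum_congr rfl fun e _ => by ring
      _ ≤ t * 2 ^ m / d ^ 2 * ((n - 2).choose (d - 2) * (I.card * J.card)) := by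
          refine mul_le_mul_of_nonneg_left ?_ (by positivity)
          rw [← hgcard]
          exact sum_edgeSum_le d hg0
      _ ≤ t * 2 ^ m * ((n - 2).choose (d - 2) * (I.card * J.card)) :=
          mul_le_mul_of_nonneg_right (div_le_self (by positivity) hd1) (by positivity)
      _ = _ := by field_simp
  have hX : 0 ≤ 2 ^ m * (n * (n - 2).choose (d - 2) * t / n) * ((I.card : ℝ) * J.card) := by
    positivity
  refine le_trans (measureReal_mono ?_) ((chernoff_weighted_sum hW h01 hind b
    (3 * subsetEntropy n I.card + 3 * subsetEntropy n J.card)).trans (le_of_eq ?_))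
  · intro ω hω
    rw [Set.mem_ofPred_eq] at hω ⊢
    have h1 : ∑ e, b e * W e ω = Real.log 2 / d ^ 2 *
        (m * ∑ i ∈ I, ∑ j ∈ J, similarityMatrix (fun e => W e ω) i j) := by
      rw [← hgsum fun i j => similarityMatrix (fun e => W e ω) i j, sum_mul_similarityMatrix, Finset.mul_sum, Finset.mul_sum]
      exact Finset.sum_congr rfl fun e _ => by simp only [hb]; ring
    -- This turns the constant `6` into the three copies of the entropies that the union bound
    -- needs.
    have hlog : 1 / 2 ≤ Real.log 2 := by linarith [Real.log_two_gt_d9]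
    rw [h1]
    set X := 2 ^ m * (n * (n - 2).choose (d - 2) * t / n) * ((I.card : ℝ) * J.card) with hXdef
    calc _ ≤ 3 * (X + subsetEntropy n I.card + subsetEntropy n J.card) := by linarith
      _ ≤ Real.log 2 * 6 * (X + subsetEntropy n I.card + subsetEntropy n J.card) :=
          mul_le_mul_of_nonneg_right (by linarith) (by positivity)
      _ = Real.log 2 / d ^ 2 *
          (6 * d ^ 2 * (X + subsetEntropy n I.card + subsetEntropy n J.card)) := by field_simp
      _ ≤ _ := mul_le_mul_of_nonneg_left hω.le (by positivity)
  · rw [← Real.exp_add]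
    ring_nf

theorem measure_not_hasBoundedDiscrepancy_le {Ω : Type*} [MeasurableSpace Ω] {μ : Measure Ω}
    [IsProbabilityMeasure μ] {n d : ℕ} (hd : 2 ≤ d) {W : HEdge n d → Ω → ℝ}
    (hW : ∀ e, Measurable (W e)) (h01 : ∀ e ω, W e ω ∈ Set.Icc (0 : ℝ) 1)
    (hind : iIndepFun W μ) {t : ℝ} (ht : 0 ≤ t) (hmean : ∀ e, ∫ ω, W e ω ∂μ ≤ t) (hn : 0 < n) :
    μ.real {ω | ¬ HasBoundedDiscrepancy (6 * d ^ 2) (n * (n - 2).choose (d - 2) * t)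
      (similarityMatrix fun e => W e ω)} ≤ 1 / n := by
  classical
  have hn' : (0 : ℝ) < n := by exact_mod_cast hn
  set NE : Finset (Finset (Fin n)) := Finset.univ.filter fun I => I.Nonempty with hNE
  set bad : Finset (Fin n) → Finset (Fin n) → ℕ → Set Ω := fun I J m =>
    {ω | 6 * d ^ 2 * (2 ^ m * (n * (n - 2).choose (d - 2) * t / n) * (I.card * J.card) +
        subsetEntropy n I.card + subsetEntropy n J.card) <
        m * ∑ i ∈ I, ∑ j ∈ J, similarityMatrix (fun e => W e ω) i j} with hbad
  have hsub : {ω | ¬ HasBoundedDiscrepancy (6 * d ^ 2) (n * (n - 2).choose (d - 2) * t)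
      (similarityMatrix fun e => W e ω)} ⊆
      ⋃ I ∈ NE, ⋃ J ∈ NE, ⋃ m ∈ Finset.Icc 1 n, bad I J m := by
    intro ω hω
    rw [Set.mem_ofPred_eq, HasBoundedDiscrepancy] at hω
    push Not at hω
    obtain ⟨I, J, hI, hJ, m, hm, h⟩ := hω
    simp only [Set.mem_iUnion]
    exact ⟨I, by simpa [hNE] using hI, J, by simpa [hNE] using hJ, m, hm, h⟩
  have hS := sum_exp_neg_subsetEntropy_le n
  have hS' : (n : ℝ) * Real.exp (-(2 * Real.log n)) = 1 / n := by
    have h2 : Real.exp (2 * Real.log n) = (n : ℝ) ^ 2 := by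
      have h3 := Real.exp_nat_mul (Real.log n) 2
      rw [Real.exp_log hn'] at h3
      exact_mod_cast h3
    rw [Real.exp_neg, h2]
    field_simp
  rw [hS'] at hS
  calc _ ≤ μ.real (⋃ I ∈ NE, ⋃ J ∈ NE, ⋃ m ∈ Finset.Icc 1 n, bad I J m) := measureReal_mono hsub (measure_ne_top _ _)
    _ ≤ ∑ I ∈ NE, ∑ J ∈ NE, ∑ m ∈ Finset.Icc 1 n, μ.real (bad I J m) :=
        (measureReal_biUnion_finset_le _ _).trans (Finset.sum_le_sum fun I _ =>
          (measureReal_biUnion_finset_le _ _).trans (Finset.sum_le_sum fun J _ =>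
            measureReal_biUnion_finset_le _ _))
    _ ≤ ∑ I ∈ NE, ∑ J ∈ NE, ∑ _m ∈ Finset.Icc 1 n, Real.exp (-(3 * subsetEntropy n I.card)) *
        Real.exp (-(3 * subsetEntropy n J.card)) :=
        Finset.sum_le_sum fun I _ => Finset.sum_le_sum fun J _ => Finset.sum_le_sum fun m _ =>
          measure_rectangle_excess_le hd hW h01 hind ht hmean hn I J m
    _ = n * ((∑ I ∈ NE, Real.exp (-(3 * subsetEntropy n I.card))) *
        ∑ J ∈ NE, Real.exp (-(3 * subsetEntropy n J.card))) := by
        rw [Finset.sum_mul_sum, Finset.mul_sum]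
        refine Finset.sum_congr rfl fun I _ => ?_
        rw [Finset.mul_sum]
        exact Finset.sum_congr rfl fun J _ => by simp
    -- The sums over `I` and over `J` give `1 / n` each; the prefactor `n` counts the values of `m`.
    _ ≤ n * (1 / n * (1 / n)) := by
        have h0 : 0 ≤ ∑ I ∈ NE, Real.exp (-(3 * subsetEntropy n I.card)) :=
          Finset.sum_nonneg fun _ _ => (Real.exp_pos _).le
        gcongr
    _ = 1 / n := by field_simp

/-! ### The contribution of the light pairs -/

/-- A Bernstein bound: the slopes `b e` lie in `[-1, 1]`, where `exp b - 1 ≤ b + b²`. Cauchy–Schwarz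
inside each edge and double counting bound the second moment by `n`; so `38 n` is `n` plus the `37
n` of the exponent. -/
theorem measure_bilinear_deviation_le {Ω : Type*} [MeasurableSpace Ω] {μ : Measure Ω}
    [IsProbabilityMeasure μ] {n d : ℕ} (hd : 2 ≤ d) {W : HEdge n d → Ω → ℝ}
    (hW : ∀ e, Measurable (W e)) (h01 : ∀ e ω, W e ω ∈ Set.Icc (0 : ℝ) 1)
    (hind : iIndepFun W μ) {t : ℝ} (hmean : ∀ e, ∫ ω, W e ω ∂μ ≤ t)
    (ht : 0 ≤ t) (hn : 0 < n) {M : ℝ} (hM : 0 < M)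
    (hMD : n * (n - 2).choose (d - 2) * t ≤ M ^ 2) {g : Fin n → Fin n → ℝ}
    (hgM : ∀ i j, |g i j| ≤ M) (hgsq : ∑ i, ∑ j, g i j ^ 2 ≤ (n : ℝ) ^ 2) :
    μ.real {ω | 38 * n * (d ^ 2 * M) < ∑ i, ∑ j, g i j *
        (similarityMatrix (fun e => W e ω) i j - similarityMatrix (fun e => ∫ ω, W e ω ∂μ) i j)} ≤
      Real.exp (-(37 * n)) := by
  have hn' : (0 : ℝ) < n := by exact_mod_cast hn
  have hd1 : (1 : ℝ) ≤ (d : ℝ) ^ 2 := by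
    have : (1 : ℝ) ≤ d := by exact_mod_cast (by omega : 1 ≤ d)
    nlinarith
  have hd0 : (0 : ℝ) < (d : ℝ) ^ 2 := by linarith
  have hdM : 0 < (d : ℝ) ^ 2 * M := by positivity
  set b : HEdge n d → ℝ := fun e => edgeSum g e / (d ^ 2 * M) with hb
  have hb1 : ∀ e, |b e| ≤ 1 := by
    intro e
    simp only [hb]
    rw [abs_div, abs_of_pos hdM, div_le_one hdM]
    exact abs_edgeSum_le hM.le hgM e
  have hmean0 : ∀ e, 0 ≤ ∫ ω, W e ω ∂μ := fun e => integral_nonneg fun ω => (h01 e ω).1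
  have hsq : ∑ e, (∫ ω, W e ω ∂μ) * b e ^ 2 ≤ n := by
    calc _ ≤ ∑ e, t * (d ^ 2 * edgeSum (fun i j => g i j ^ 2) e / (d ^ 2 * M) ^ 2) := by
          refine Finset.sum_le_sum fun e _ => mul_le_mul (hmean e) ?_ (sq_nonneg _) ht
          simp only [hb]
          rw [div_pow]
          exact div_le_div_of_nonneg_right (edgeSum_sq_le g e) (by positivity)
      _ = t / (d ^ 2 * M ^ 2) * ∑ e : HEdge n d, edgeSum (fun i j => g i j ^ 2) e := by
          rw [Finset.mul_sum]
          exact Finset.sum_congr rfl fun e _ => by field_simp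
      _ ≤ t / (d ^ 2 * M ^ 2) * ((n - 2).choose (d - 2) * n ^ 2) := by
          refine mul_le_mul_of_nonneg_left ?_ (by positivity)
          exact (sum_edgeSum_le d fun i j => sq_nonneg _).trans
            (mul_le_mul_of_nonneg_left hgsq (Nat.cast_nonneg _))
      _ = n * ((n * (n - 2).choose (d - 2) * t) / (d ^ 2 * M ^ 2)) := by ring
      _ ≤ n * 1 := by
          refine mul_le_mul_of_nonneg_left ((div_le_one (by positivity)).2 ?_) hn'.le
          nlinarith [sq_nonneg M]
      _ = n := mul_one _
  have hvar : ∑ e, (∫ ω, W e ω ∂μ) * (Real.exp (b e) - 1) ≤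
      ∑ e, b e * (∫ ω, W e ω ∂μ) + n := by
    refine le_trans ?_ (add_le_add_right hsq _)
    rw [← Finset.sum_add_distrib]
    refine Finset.sum_le_sum fun e _ => ?_
    have h1 := (le_abs_self _).trans (Real.abs_exp_sub_one_sub_id_le (hb1 e))
    have h2 := mul_le_mul_of_nonneg_left h1 (hmean0 e)
    linarith
  refine le_trans (measureReal_mono ?_) (chernoff_weighted_sum hW h01 hind b (37 * n))
  intro ω hω
  rw [Set.mem_ofPred_eq] at hω ⊢
  simp only [mul_sub, Finset.sum_sub_distrib] at hω
  rw [sum_mul_similarityMatrix, sum_mul_similarityMatrix] at hω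
  have h1 : ∀ f : HEdge n d → ℝ, ∑ e, b e * f e = (∑ e, edgeSum g e * f e) / (d ^ 2 * M) := by
    intro f
    rw [Finset.sum_div]
    exact Finset.sum_congr rfl fun e _ => by simp only [hb]; ring
  have h2 := (lt_div_iff₀ hdM).2 hω
  rw [sub_div, ← h1, ← h1] at h2
  linarith

/-- The part of the rank one matrix `u vᵀ` on the pairs whose dyadic levels add up to at most
`s`. -/
noncomputable def lightPart {n : ℕ} (s : ℕ) (u v : Fin n → ℝ) (i j : Fin n) : ℝ :=
  if dyadicLevel (u i) + dyadicLevel (v j) ≤ s then u i * v j else 0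

theorem abs_lightPart_le {n : ℕ} (s : ℕ) (u v : Fin n → ℝ) (i j : Fin n) :
    |lightPart s u v i j| ≤ 4 * 2 ^ s := by
  rw [lightPart]
  split_ifs with h
  · rw [abs_mul]
    calc |u i| * |v j| ≤ 2 ^ (dyadicLevel (u i) + 1) * 2 ^ (dyadicLevel (v j) + 1) :=
          mul_le_mul (abs_lt_two_pow_dyadicLevel _).le (abs_lt_two_pow_dyadicLevel _).le
            (abs_nonneg _) (by positivity)
      _ = 4 * 2 ^ (dyadicLevel (u i) + dyadicLevel (v j)) := by
          rw [pow_succ, pow_succ, pow_add]; ring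
      _ ≤ 4 * 2 ^ s := by gcongr; norm_num
  · simp

theorem sum_lightPart_sq_le {n : ℕ} (s : ℕ) {u v : Fin n → ℝ} (hu : ∑ i, u i ^ 2 ≤ n)
    (hv : ∑ i, v i ^ 2 ≤ n) : ∑ i, ∑ j, lightPart s u v i j ^ 2 ≤ (n : ℝ) ^ 2 := by
  calc _ ≤ ∑ i, ∑ j, u i ^ 2 * v j ^ 2 := by
        refine Finset.sum_le_sum fun i _ => Finset.sum_le_sum fun j _ => ?_
        rw [lightPart]
        split_ifs
        · rw [mul_pow]
        · rw [zero_pow two_ne_zero]; positivity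
    _ = (∑ i, u i ^ 2) * ∑ j, v j ^ 2 := by rw [Finset.sum_mul_sum]
    _ ≤ n * n := mul_le_mul hu hv (Finset.sum_nonneg fun _ _ => sq_nonneg _) (Nat.cast_nonneg n)
    _ = _ := (sq _).symm

/-- On the net, the light part of the bilinear form of `A` is close to that of `Q`. -/
def HasLightBound {n : ℕ} (s : ℕ) (B : ℝ) (A Q : Matrix (Fin n) (Fin n) ℝ) : Prop :=
  ∀ z ∈ latticeNet n, ∀ w ∈ latticeNet n, ∑ i, ((z i : ℝ) / 4) ^ 2 ≤ (n : ℝ) →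
    ∑ i, ((w i : ℝ) / 4) ^ 2 ≤ (n : ℝ) →
    |∑ i, ∑ j, lightPart s (fun i => (z i : ℝ) / 4) (fun i => (w i : ℝ) / 4) i j *
      (A i j - Q i j)| ≤ B

theorem measure_not_hasLightBound_le {Ω : Type*} [MeasurableSpace Ω] {μ : Measure Ω}
    [IsProbabilityMeasure μ] {n d s : ℕ} (hd : 2 ≤ d) {W : HEdge n d → Ω → ℝ}
    (hW : ∀ e, Measurable (W e)) (h01 : ∀ e ω, W e ω ∈ Set.Icc (0 : ℝ) 1)
    (hind : iIndepFun W μ) {t : ℝ} (hmean : ∀ e, ∫ ω, W e ω ∂μ ≤ t)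
    (ht : 0 ≤ t) (hn : 0 < n) (hs : √(n * (n - 2).choose (d - 2) * t) ≤ 2 * 2 ^ s) :
    μ.real {ω | ¬ HasLightBound s (38 * n * (d ^ 2 * (4 * 2 ^ s)))
      (similarityMatrix fun e => W e ω) (similarityMatrix fun e => ∫ ω, W e ω ∂μ)} ≤ 2 / n := by
  classical
  have hn' : (0 : ℝ) < n := by exact_mod_cast hn
  have hM : (0 : ℝ) < 4 * 2 ^ s := by positivity
  have hMD : n * (n - 2).choose (d - 2) * t ≤ (4 * 2 ^ s : ℝ) ^ 2 := by
    have h0 : (0 : ℝ) ≤ n * (n - 2).choose (d - 2) * t := by positivity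
    rw [← Real.sqrt_le_left hM.le]
    linarith [show (0 : ℝ) < 2 ^ s by positivity]
  set g : (Fin n → ℤ) → (Fin n → ℤ) → Fin n → Fin n → ℝ := fun z w =>
    lightPart s (fun i => (z i : ℝ) / 4) (fun i => (w i : ℝ) / 4) with hg
  set bad : (Fin n → Fin n → ℝ) → Set Ω := fun g =>
    {ω | 38 * n * (d ^ 2 * (4 * 2 ^ s)) < ∑ i, ∑ j, g i j * (similarityMatrix (fun e => W e ω) i j
      - similarityMatrix (fun e => ∫ ω, W e ω ∂μ) i j)} with hbad
  set T : Finset (Fin n → ℤ) := (latticeNet n).filter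
    fun z => ∑ i, ((z i : ℝ) / 4) ^ 2 ≤ (n : ℝ) with hT
  have hsub : {ω | ¬ HasLightBound s (38 * n * (d ^ 2 * (4 * 2 ^ s)))
      (similarityMatrix fun e => W e ω) (similarityMatrix fun e => ∫ ω, W e ω ∂μ)} ⊆
      ⋃ z ∈ T, ⋃ w ∈ T, bad (g z w) ∪ bad (fun i j => -g z w i j) := by
    intro ω hω
    rw [Set.mem_ofPred_eq, HasLightBound] at hω
    push Not at hω
    obtain ⟨z, hz, w, hw, hz', hw', h⟩ := hω
    simp only [Set.mem_iUnion]
    refine ⟨z, Finset.mem_filter.2 ⟨hz, hz'⟩, w, Finset.mem_filter.2 ⟨hw, hw'⟩, ?_⟩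
    rcases lt_abs.1 h with h | h
    · exact Or.inl h
    · refine Or.inr ?_
      simp only [hbad, Set.mem_ofPred_eq, neg_mul, Finset.sum_neg_distrib]
      exact h
  have hone : ∀ z ∈ T, ∀ w ∈ T, μ.real (bad (g z w) ∪ bad (fun i j => -g z w i j)) ≤
      2 * Real.exp (-(37 * n)) := by
    intro z hz w hw
    have hsq := sum_lightPart_sq_le s (Finset.mem_filter.1 hz).2 (Finset.mem_filter.1 hw).2
    have h1 := measure_bilinear_deviation_le hd hW h01 hind hmean ht hn hM hMD
      (abs_lightPart_le s (fun i => (z i : ℝ) / 4) (fun i => (w i : ℝ) / 4)) hsq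
    have h2 := measure_bilinear_deviation_le hd hW h01 hind hmean ht hn hM hMD
      (g := fun i j => -g z w i j)
      (fun i j => by
        rw [abs_neg]
        exact abs_lightPart_le s (fun i => (z i : ℝ) / 4) (fun i => (w i : ℝ) / 4) i j)
      (by simpa only [neg_sq] using hsq)
    calc _ ≤ μ.real (bad (g z w)) + μ.real (bad (fun i j => -g z w i j)) :=
          measureReal_union_le _ _
      _ ≤ _ := by linarith
  have hTcard : (T.card : ℝ) ≤ Real.exp (18 * n) :=
    le_trans (by exact_mod_cast Finset.card_le_card (Finset.filter_subset _ _))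
      (card_latticeNet_le n)
  calc _ ≤ μ.real (⋃ z ∈ T, ⋃ w ∈ T, bad (g z w) ∪ bad (fun i j => -g z w i j)) :=
        measureReal_mono hsub (measure_ne_top _ _)
    _ ≤ ∑ z ∈ T, ∑ w ∈ T, μ.real (bad (g z w) ∪ bad (fun i j => -g z w i j)) :=
        (measureReal_biUnion_finset_le _ _).trans (Finset.sum_le_sum fun z _ =>
          measureReal_biUnion_finset_le _ _)
    _ ≤ ∑ z ∈ T, ∑ w ∈ T, 2 * Real.exp (-(37 * n)) :=
        Finset.sum_le_sum fun z hz => Finset.sum_le_sum fun w hw => hone z hz w hw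
    _ = T.card * (T.card * (2 * Real.exp (-(37 * n)))) := by
        simp only [Finset.sum_const, nsmul_eq_mul]
    -- Two nets of size `e^(18n)` against `e^(-37n)` leave `e^(-n)`.
    _ ≤ Real.exp (18 * n) * (Real.exp (18 * n) * (2 * Real.exp (-(37 * n)))) := by gcongr
    _ = 2 * Real.exp (-n) := by
        rw [mul_left_comm _ (2 : ℝ), mul_left_comm _ (2 : ℝ), ← Real.exp_add, ← Real.exp_add]
        ring_nf
    _ ≤ 2 / n := by
        rw [Real.exp_neg, ← div_eq_mul_inv]
        refine div_le_div_of_nonneg_left zero_le_two hn' ?_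
        linarith [Real.add_one_le_exp (n : ℝ)]

/-! ### The population matrix -/

theorem integral_similarityMatrix {Ω : Type*} [MeasurableSpace Ω] {μ : Measure Ω} {n d : ℕ}
    {W : HEdge n d → Ω → ℝ} (hW : ∀ e, Integrable (W e) μ) (i j : Fin n) :
    ∫ ω, similarityMatrix (fun e => W e ω) i j ∂μ =
      similarityMatrix (fun e => ∫ ω, W e ω ∂μ) i j := by
  simp only [similarityMatrix_eq_sum_offDiag]
  rw [integral_finsetSum]
  · refine Finset.sum_congr rfl fun e _ => ?_
    split_ifs <;> simp
  · intro e _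
    split_ifs
    · exact hW e
    · exact integrable_zero _ _ _

/-- The action of a permutation of the nodes on the hyperedges. -/
def permHEdge {n : ℕ} (d : ℕ) (σ : Equiv.Perm (Fin n)) : HEdge n d ≃ HEdge n d :=
  (Equiv.finsetCongr σ).subtypeEquiv fun e => by simp

theorem mem_permHEdge {n d : ℕ} (σ : Equiv.Perm (Fin n)) (e : HEdge n d) (i : Fin n) :
    σ i ∈ (permHEdge d σ e).1 ↔ i ∈ e.1 := by
  simp [permHEdge]

theorem similarityMatrix_perm {n d : ℕ} (σ : Equiv.Perm (Fin n)) {w : HEdge n d → ℝ}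
    (hw : ∀ e, w (permHEdge d σ e) = w e) (i j : Fin n) :
    similarityMatrix w (σ i) (σ j) = similarityMatrix w i j := by
  simp only [similarityMatrix, Matrix.of_apply, σ.injective.eq_iff]
  split_ifs with h
  · rfl
  · rw [← Equiv.sum_comp (permHEdge d σ)]
    simp only [mem_permHEdge, hw]

theorem isHomogeneous_permHEdge {n d k : ℕ} {Ψ : Fin n → Fin k} {σ : Equiv.Perm (Fin n)}
    (hσ : ∀ i, Ψ (σ i) = Ψ i) (e : HEdge n d) :
    IsHomogeneous Ψ (permHEdge d σ e) ↔ IsHomogeneous Ψ e := by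
  constructor
  · intro h i hi j hj
    rw [← hσ i, ← hσ j]
    exact h _ ((mem_permHEdge σ e i).2 hi) _ ((mem_permHEdge σ e j).2 hj)
  · intro h i hi j hj
    obtain ⟨i, rfl⟩ := σ.surjective i
    obtain ⟨j, rfl⟩ := σ.surjective j
    rw [hσ, hσ]
    exact h _ ((mem_permHEdge σ e i).1 hi) _ ((mem_permHEdge σ e j).1 hj)

/-- Two pairs of distinct nodes with the same labels are related by a permutation of the nodes
that preserves the labels. -/
theorem exists_perm_of_labels_eq {n k : ℕ} {Ψ : Fin n → Fin k} {i j i' j' : Fin n} (hij : i ≠ j)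
    (hij' : i' ≠ j') (hi : Ψ i = Ψ i') (hj : Ψ j = Ψ j') :
    ∃ σ : Equiv.Perm (Fin n), (∀ x, Ψ (σ x) = Ψ x) ∧ σ i = i' ∧ σ j = j' := by
  have hswap : ∀ {x y : Fin n}, Ψ x = Ψ y → ∀ z, Ψ (Equiv.swap x y z) = Ψ z := by
    intro x y hxy z
    rw [Equiv.swap_apply_def]
    split_ifs with h1 h2
    · rw [h1, hxy]
    · rw [h2, hxy]
    · rfl
  -- The second swap must leave `i'`, the image of `i`, in place.
  have hne : i' ≠ Equiv.swap i i' j := by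
    intro h
    apply hij
    apply (Equiv.swap i i').injective
    rw [Equiv.swap_apply_left, ← h]
  refine ⟨Equiv.swap (Equiv.swap i i' j) j' * Equiv.swap i i', fun x => ?_, ?_, ?_⟩
  · rw [Equiv.Perm.mul_apply, hswap, hswap hi]
    rw [hswap hi, hj]
  · rw [Equiv.Perm.mul_apply, Equiv.swap_apply_left, Equiv.swap_apply_of_ne_of_ne hne hij']
  · rw [Equiv.Perm.mul_apply, Equiv.swap_apply_left]

theorem populationMatrix_apply {Ω : Type*} [MeasurableSpace Ω] (μ : Measure Ω) {n d k : ℕ}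
    (Ψ : Fin n → Fin k) (W : HEdge n d → Ω → ℝ) (i j : Fin n) :
    populationMatrix μ Ψ W i j = blockMatrix μ Ψ W (Ψ i) (Ψ j) := by
  simp [populationMatrix, membershipMatrix, Matrix.mul_apply]

namespace IsWeightedSBM

variable {Ω : Type*} [MeasurableSpace Ω] {μ : Measure Ω} {n d k : ℕ}
  {Ψ : Fin n → Fin k} {p q α : ℝ} {W : HEdge n d → Ω → ℝ}

theorem integrable [IsProbabilityMeasure μ] (h : IsWeightedSBM μ Ψ p q α W) (e : HEdge n d) : Integrable (W e) μ :=
  integrable_of_mem_Icc (h.measurable_weight e) (h.weight_mem e)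

theorem mean_nonneg (h : IsWeightedSBM μ Ψ p q α W) (e : HEdge n d) : 0 ≤ ∫ ω, W e ω ∂μ :=
  integral_nonneg fun ω => (h.weight_mem e ω).1

theorem mean_le (h : IsWeightedSBM μ Ψ p q α W) (hqp : q ≤ p) (hα : 0 ≤ α) (e : HEdge n d) :
    ∫ ω, W e ω ∂μ ≤ p * α := by
  by_cases he : IsHomogeneous Ψ e
  · exact (h.mean_homogeneous e he).le
  · rw [h.mean_heterogeneous e he]
    exact mul_le_mul_of_nonneg_right hqp hα

/-- The mean weights are invariant under label-preserving permutations, which act transitively on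
the pairs with given labels; the choice in `blockMatrix` is therefore immaterial. -/
theorem mean_similarityMatrix_eq (h : IsWeightedSBM μ Ψ p q α W) {i j i' j' : Fin n}
    (hij : i ≠ j) (hij' : i' ≠ j') (hi : Ψ i = Ψ i') (hj : Ψ j = Ψ j') :
    similarityMatrix (fun e => ∫ ω, W e ω ∂μ) i j =
      similarityMatrix (fun e => ∫ ω, W e ω ∂μ) i' j' := by
  obtain ⟨σ, hσ, rfl, rfl⟩ := exists_perm_of_labels_eq hij hij' hi hj
  refine (similarityMatrix_perm σ (fun e => ?_) i j).symm
  by_cases he : IsHomogeneous Ψ e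
  · rw [h.mean_homogeneous e he,
      h.mean_homogeneous _ ((isHomogeneous_permHEdge hσ e).2 he)]
  · rw [h.mean_heterogeneous e he,
      h.mean_heterogeneous _ (mt (isHomogeneous_permHEdge hσ e).1 he)]

theorem populationMatrix_eq [IsProbabilityMeasure μ] (h : IsWeightedSBM μ Ψ p q α W) {i j : Fin n} (hij : i ≠ j) :
    populationMatrix μ Ψ W i j = similarityMatrix (fun e => ∫ ω, W e ω ∂μ) i j := by
  have hex : ∃ x : Fin n × Fin n, x.1 ≠ x.2 ∧ Ψ x.1 = Ψ i ∧ Ψ x.2 = Ψ j := ⟨(i, j), hij, rfl, rfl⟩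
  rw [populationMatrix_apply, blockMatrix, Matrix.of_apply, dif_pos hex,
    integral_similarityMatrix h.integrable]
  exact h.mean_similarityMatrix_eq hex.choose_spec.1 hij hex.choose_spec.2.1 hex.choose_spec.2.2

/-- The diagonal is included: there `P` need not vanish, unlike the matrix of means. -/
theorem populationMatrix_mem_Icc [IsProbabilityMeasure μ] (h : IsWeightedSBM μ Ψ p q α W)
    (hqp : q ≤ p) (hα : 0 ≤ α) (hp : 0 ≤ p) (i j : Fin n) :
    populationMatrix μ Ψ W i j ∈ Set.Icc 0 ((n - 2).choose (d - 2) * (p * α)) := by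
  have hpα := mul_nonneg hp hα
  rw [populationMatrix_apply, blockMatrix, Matrix.of_apply]
  split_ifs with hex
  · rw [integral_similarityMatrix h.integrable]
    exact ⟨similarityMatrix_nonneg h.mean_nonneg _ _,
      similarityMatrix_le hpα (h.mean_le hqp hα) _ _⟩
  · exact ⟨le_rfl, by positivity⟩

end IsWeightedSBM

/-! ### The total weight -/

theorem pow_le_mul_choose {m d : ℕ} {x : ℝ} (hx : x ≤ m) (hd : 2 * (d : ℝ) ≤ x) :
    (x / 2) ^ d ≤ d.factorial * m.choose d := by
  have h1 : ((m + 1 - d : ℕ) : ℝ) ^ d ≤ (m.descFactorial d : ℕ) := by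
    exact_mod_cast Nat.pow_sub_le_descFactorial m d
  have hd0 : (0 : ℝ) ≤ d := Nat.cast_nonneg d
  have hdm : d ≤ m + 1 := by
    have : (d : ℝ) ≤ m := by linarith
    have : d ≤ m := by exact_mod_cast this
    omega
  rw [Nat.descFactorial_eq_factorial_mul_choose, Nat.cast_mul] at h1
  refine le_trans (pow_le_pow_left₀ (by linarith) ?_ d) h1
  rw [Nat.cast_sub hdm]
  push_cast
  linarith

theorem choose_mul_sq_le_pow {n d : ℕ} (hd : 2 ≤ d) :
    ((n - 2).choose (d - 2) : ℝ) * n ^ 2 ≤ n ^ d := by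
  have h : (n - 2).choose (d - 2) * n ^ 2 ≤ n ^ d := by
    calc (n - 2).choose (d - 2) * n ^ 2 ≤ n ^ (d - 2) * n ^ 2 := by
          refine Nat.mul_le_mul_right _ ((Nat.choose_le_pow _ _).trans ?_)
          exact Nat.pow_le_pow_left (Nat.sub_le _ _) _
      _ = n ^ d := by rw [← pow_add]; congr 1; omega
  exact_mod_cast h

/-- A lower bound for the proportion of homogeneous edges. -/
noncomputable def homogeneousRatio (d k : ℕ) : ℝ := 1 / ((2 * (k + 1)) ^ d * d.factorial)

theorem homogeneousRatio_pos (d k : ℕ) : 0 < homogeneousRatio d k := by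
  rw [homogeneousRatio]; positivity

/-- By pigeonhole some group has at least `n / (k + 1)` nodes. All of its `d`-subsets are
homogeneous, and they form a fixed proportion of `n^d`. -/
theorem IsWeightedSBM.le_sum_mean {Ω : Type*} [MeasurableSpace Ω] {μ : Measure Ω}
    [IsProbabilityMeasure μ] {n d k : ℕ} {Ψ : Fin n → Fin k} {p q α : ℝ} {W : HEdge n d → Ω → ℝ}
    (h : IsWeightedSBM μ Ψ p q α W) (hd : 2 ≤ d) (hpα : 0 ≤ p * α)
    (hn : 2 * (d : ℝ) * (k + 1) ≤ n) (hn0 : 0 < n) :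
    homogeneousRatio d k * (n * (n * (n - 2).choose (d - 2) * (p * α))) ≤
      ∑ e, ∫ ω, W e ω ∂μ := by
  classical
  have hk1 : (0 : ℝ) < (k : ℝ) + 1 := by positivity
  have hk : (Finset.univ : Finset (Fin k)).Nonempty := ⟨Ψ ⟨0, hn0⟩, Finset.mem_univ _⟩
  obtain ⟨l, -, hl⟩ := Finset.exists_le_card_fiber_of_nsmul_le_card_of_maps_to
    (s := (Finset.univ : Finset (Fin n))) (f := Ψ) (b := (n : ℝ) / (k + 1))
    (fun i _ => Finset.mem_univ (Ψ i)) hk (by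
      simp only [Finset.card_univ, Fintype.card_fin, nsmul_eq_mul]
      rw [mul_div_assoc', div_le_iff₀ hk1]
      nlinarith [Nat.cast_nonneg (α := ℝ) n])
  set G : Finset (Fin n) := Finset.univ.filter fun i => Ψ i = l with hG
  have hchoose := pow_le_mul_choose (d := d) hl (by rw [le_div_iff₀ hk1]; exact hn)
  have hcount : ((G.card.choose d : ℕ) : ℝ) * (p * α) ≤ ∑ e, ∫ ω, W e ω ∂μ := by
    have hcard : G.card.choose d ≤ (Finset.univ.filter fun e : HEdge n d => e.1 ⊆ G).card := by
      rw [← Finset.card_powersetCard]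
      refine Finset.card_le_card_of_surjOn (fun e => e.1) ?_
      intro e he
      rw [Finset.mem_coe, Finset.mem_powersetCard] at he
      exact ⟨⟨e, he.2⟩, by simpa using he.1, rfl⟩
    calc _ ≤ ((Finset.univ.filter fun e : HEdge n d => e.1 ⊆ G).card : ℝ) * (p * α) :=
          mul_le_mul_of_nonneg_right (by exact_mod_cast hcard) hpα
      _ = ∑ e : HEdge n d with e.1 ⊆ G, ∫ ω, W e ω ∂μ := by
          rw [← nsmul_eq_mul, ← Finset.sum_const]
          refine Finset.sum_congr rfl fun e he => (h.mean_homogeneous e ?_).symm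
          intro i hi j hj
          have hsub := (Finset.mem_filter.1 he).2
          rw [(Finset.mem_filter.1 (hsub hi)).2, (Finset.mem_filter.1 (hsub hj)).2]
      _ ≤ _ := Finset.sum_le_sum_of_subset_of_nonneg (Finset.filter_subset _ _)
          fun e _ _ => h.mean_nonneg e
  refine le_trans ?_ hcount
  calc homogeneousRatio d k * (n * (n * (n - 2).choose (d - 2) * (p * α)))
      = homogeneousRatio d k * ((n - 2).choose (d - 2) * n ^ 2) * (p * α) := by ring
    _ ≤ homogeneousRatio d k * n ^ d * (p * α) :=
        mul_le_mul_of_nonneg_right (mul_le_mul_of_nonneg_left (choose_mul_sq_le_pow hd)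
          (homogeneousRatio_pos d k).le) hpα
    _ = ((n : ℝ) / (k + 1) / 2) ^ d / d.factorial * (p * α) := by
        rw [homogeneousRatio, div_div, div_pow, mul_comm ((k : ℝ) + 1) 2]
        field_simp
    _ ≤ _ := by
        refine mul_le_mul_of_nonneg_right ?_ hpα
        rw [div_le_iff₀ (by positivity), mul_comm]
        exact hchoose

theorem measure_sum_le_half_mean_le {Ω ι : Type*} [Fintype ι] [MeasurableSpace Ω] {μ : Measure Ω}
    [IsProbabilityMeasure μ] {W : ι → Ω → ℝ} (hW : ∀ e, Measurable (W e))
    (h01 : ∀ e ω, W e ω ∈ Set.Icc (0 : ℝ) 1) (hind : iIndepFun W μ) {T : ℝ} (hT : 0 < T)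
    (hmean : T ≤ ∑ e, ∫ ω, W e ω ∂μ) :
    μ.real {ω | ∑ e, W e ω ≤ T / 2} ≤ 10 / T := by
  refine le_trans (measureReal_mono ?_ (measure_ne_top _ _))
    ((chernoff_weighted_sum hW h01 hind (fun _ => -1) (T / 10)).trans ?_)
  · intro ω hω
    rw [Set.mem_ofPred_eq] at hω ⊢
    -- What is needed is `1 - e⁻¹ - 1/10 ≥ 1/2`.
    have he := Real.exp_neg_one_lt_d9
    rw [← Finset.sum_mul, ← Finset.mul_sum]
    nlinarith
  · rw [Real.exp_neg, inv_le_comm₀ (Real.exp_pos _) (by positivity), inv_div]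
    linarith [Real.add_one_le_exp (T / 10)]

theorem sum_le_sum_similarityMatrix {n d : ℕ} (hd : 2 ≤ d) {w : HEdge n d → ℝ}
    (hw : ∀ e, 0 ≤ w e) : ∑ e, w e ≤ ∑ i, ∑ j, similarityMatrix w i j := by
  have h := sum_mul_similarityMatrix (fun _ _ => 1) w
  simp only [one_mul] at h
  rw [h]
  refine Finset.sum_le_sum fun e _ => le_mul_of_one_le_left (hw e) ?_
  simp only [edgeSum, Finset.sum_const, nsmul_eq_mul, mul_one, Finset.offDiag_card, e.2]
  have h1 : 1 ≤ d * d - d := by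
    have : d * 2 ≤ d * d := Nat.mul_le_mul_left d hd
    omega
  exact_mod_cast h1

/-! ### The processed matrix -/

theorem similarityMatrix_comm {n d : ℕ} (w : HEdge n d → ℝ) (i j : Fin n) :
    similarityMatrix w i j = similarityMatrix w j i := by
  simp only [similarityMatrix, Matrix.of_apply, eq_comm (a := i), and_comm]

theorem processedMatrix_nonneg {n : ℕ} (c : ℝ) {A : Matrix (Fin n) (Fin n) ℝ}
    (hA : ∀ i j, 0 ≤ A i j) (i j : Fin n) : 0 ≤ processedMatrix c A i j := by
  rw [processedMatrix, Matrix.of_apply]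
  split_ifs
  exacts [le_rfl, hA i j]

theorem processedMatrix_le {n : ℕ} (c : ℝ) {A : Matrix (Fin n) (Fin n) ℝ}
    (hA : ∀ i j, 0 ≤ A i j) (i j : Fin n) : processedMatrix c A i j ≤ A i j := by
  rw [processedMatrix, Matrix.of_apply]
  split_ifs
  exacts [hA i j, le_rfl]

theorem processedMatrix_comm {n : ℕ} (c : ℝ) {A : Matrix (Fin n) (Fin n) ℝ}
    (hA : ∀ i j, A i j = A j i) (i j : Fin n) :
    processedMatrix c A i j = processedMatrix c A j i := by
  simp only [processedMatrix, Matrix.of_apply, hA i j]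
  split_ifs <;> first | rfl | tauto

theorem sum_processedMatrix_le {n : ℕ} {c b : ℝ} (hb : 0 ≤ b) {A : Matrix (Fin n) (Fin n) ℝ}
    (hA : ∀ i j, 0 ≤ A i j) (h : c * ((1 / (n : ℝ)) * ∑ i, ∑ j, A i j) ≤ b) (i : Fin n) :
    ∑ j, processedMatrix c A i j ≤ b := by
  by_cases hi : IsRemoved c A i
  · simp only [processedMatrix, Matrix.of_apply, hi, true_or, if_true, Finset.sum_const_zero]
    exact hb
  · exact (Finset.sum_le_sum fun j _ => processedMatrix_le c hA i j).trans ((not_lt.1 hi).trans h)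

namespace HasBoundedDiscrepancy

variable {n : ℕ} {C D : ℝ} {A : Matrix (Fin n) (Fin n) ℝ}

theorem mono (h : HasBoundedDiscrepancy C D A) {A' : Matrix (Fin n) (Fin n) ℝ}
    (hle : ∀ i j, A' i j ≤ A i j) : HasBoundedDiscrepancy C D A' := fun I J hI hJ m hm =>
  le_trans (mul_le_mul_of_nonneg_left
    (Finset.sum_le_sum fun i _ => Finset.sum_le_sum fun j _ => hle i j) (Nat.cast_nonneg m))
    (h I J hI hJ m hm)

theorem sum_rows_le (h : HasBoundedDiscrepancy C D A) (hC : 0 ≤ C) (hn : 0 < n)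
    (I : Finset (Fin n)) : ∑ i ∈ I, ∑ j, A i j ≤ 2 * C * (D * I.card + n) := by
  rcases I.eq_empty_or_nonempty with rfl | hI
  · rw [Finset.sum_empty, Finset.card_empty, Nat.cast_zero, mul_zero, zero_add]
    positivity
  have hn' : (0 : ℝ) < n := by exact_mod_cast hn
  -- The rectangle `I × [n]` with `m = 1`; both entropies are at most `n`.
  have h1 := h I Finset.univ hI ⟨⟨0, hn⟩, Finset.mem_univ _⟩ 1 (Finset.mem_Icc.2 ⟨le_rfl, hn⟩)
  have h2 := subsetEntropy_le (n := n) (r := I.card) (by simpa using I.card_le_univ)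
  have h3 := subsetEntropy_le (le_refl n)
  simp only [Nat.cast_one, one_mul, pow_one, Finset.card_univ, Fintype.card_fin] at h1
  calc _ ≤ C * (2 * (D / n) * (I.card * n) + n + n) :=
        h1.trans (mul_le_mul_of_nonneg_left (by linarith) hC)
    _ = _ := by field_simp; ring

/-- At most `n / D` rows have a sum exceeding `4 C D`. -/
theorem card_mul_le (h : HasBoundedDiscrepancy C D A) (hC : 0 < C) (hn : 0 < n)
    {R : Finset (Fin n)} (hR : ∀ i ∈ R, 4 * C * D ≤ ∑ j, A i j) : R.card * D ≤ n := by
  have h1 := h.sum_rows_le hC.le hn R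
  have h2 : R.card * (4 * C * D) ≤ ∑ i ∈ R, ∑ j, A i j := by
    rw [← nsmul_eq_mul]
    exact Finset.card_nsmul_le_sum R _ _ hR
  have h3 : 2 * C * (R.card * D) ≤ 2 * C * n := by linarith
  exact le_of_mul_le_mul_left h3 (by positivity)

end HasBoundedDiscrepancy

/-! ### Bilinear forms of bounded matrices -/

theorem sum_abs_le {n : ℕ} {u : Fin n → ℝ} (hu : ∑ i, u i ^ 2 ≤ n) : ∑ i, |u i| ≤ n := by
  have h : ∀ i, |u i| ≤ (u i ^ 2 + 1) / 2 := fun i => by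
    rw [← sq_abs]; nlinarith [sq_nonneg (|u i| - 1)]
  refine (Finset.sum_le_sum fun i _ => h i).trans ?_
  rw [← Finset.sum_div, Finset.sum_add_distrib]
  simp only [Finset.sum_const, Finset.card_univ, Fintype.card_fin, nsmul_eq_mul, mul_one]
  linarith

theorem sum_abs_mul_max_le {n : ℕ} {u : Fin n → ℝ} (hu : ∑ i, u i ^ 2 ≤ n) :
    ∑ i, |u i| * max |u i| 1 ≤ 2 * n := by
  have h : ∀ i, |u i| * max |u i| 1 ≤ u i ^ 2 + |u i| := fun i => by
    have h0 := abs_nonneg (u i)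
    calc |u i| * max |u i| 1 ≤ |u i| * (|u i| + 1) := by
          refine mul_le_mul_of_nonneg_left (max_le (by linarith) (by linarith)) h0
      _ = _ := by rw [← sq_abs]; ring
  refine (Finset.sum_le_sum fun i _ => h i).trans ?_
  rw [Finset.sum_add_distrib]
  linarith [sum_abs_le hu]

/-- On a heavy pair `√D ≤ 2^(s+1) ≤ max |u i| 1 * max |v j| 1`, so multiplying by this product pays
for the factor `√D`, and the sum then factorises. -/
theorem heavy_mean_sum_le {n s : ℕ} {D : ℝ} (hD : 0 < D) (hs' : √D ≤ 2 * 2 ^ s)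
    {u v : Fin n → ℝ} (hu : ∑ i, u i ^ 2 ≤ n) (hv : ∑ i, v i ^ 2 ≤ n) :
    ∑ i, ∑ j, (if dyadicLevel (u i) + dyadicLevel (v j) ≤ s then 0 else |u i| * |v j|) ≤
      4 * n ^ 2 / √D := by
  have hsD : 0 < √D := Real.sqrt_pos.2 hD
  rw [le_div_iff₀ hsD]
  calc _ ≤ ∑ i, ∑ j, (|u i| * max |u i| 1) * (|v j| * max |v j| 1) := by
        rw [Finset.sum_mul]
        refine Finset.sum_le_sum fun i _ => ?_
        rw [Finset.sum_mul]
        refine Finset.sum_le_sum fun j _ => ?_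
        split_ifs with h
        · rw [zero_mul]; positivity
        · have h1 : √D ≤ max |u i| 1 * max |v j| 1 := by
            calc √D ≤ 2 ^ (s + 1) := by rw [pow_succ]; linarith
              _ ≤ 2 ^ (dyadicLevel (u i) + dyadicLevel (v j)) :=
                  pow_le_pow_right₀ one_le_two (by omega)
              _ = 2 ^ dyadicLevel (u i) * 2 ^ dyadicLevel (v j) := pow_add _ _ _
              _ ≤ _ := mul_le_mul (two_pow_dyadicLevel_le_max _) (two_pow_dyadicLevel_le_max _)
                  (by positivity) (by positivity)
          calc |u i| * |v j| * √D ≤ |u i| * |v j| * (max |u i| 1 * max |v j| 1) := by gcongr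
            _ = _ := by ring
    _ = (∑ i, |u i| * max |u i| 1) * ∑ j, |v j| * max |v j| 1 := by rw [Finset.sum_mul_sum]
    _ ≤ (2 * n) * (2 * n) := mul_le_mul (sum_abs_mul_max_le hu) (sum_abs_mul_max_le hv)
        (Finset.sum_nonneg fun _ _ => by positivity) (by positivity)
    _ = _ := by ring

theorem sum_abs_subset_le {n : ℕ} {D : ℝ} (hD : 0 < D) {R : Finset (Fin n)}
    (hR : R.card * D ≤ n) {u : Fin n → ℝ} (hu : ∑ i, u i ^ 2 ≤ n) :
    ∑ i ∈ R, |u i| ≤ n / √D := by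
  have hsD : 0 < √D := Real.sqrt_pos.2 hD
  have h1 : (∑ i ∈ R, |u i|) ^ 2 ≤ R.card * n := by
    refine sq_sum_le_card_mul_sum_sq.trans (mul_le_mul_of_nonneg_left ?_ (Nat.cast_nonneg _))
    simp only [sq_abs]
    exact (Finset.sum_le_sum_of_subset_of_nonneg (Finset.subset_univ R)
      fun i _ _ => sq_nonneg _).trans hu
  refine abs_le_of_sq_le_sq' ?_ (by positivity) |>.2
  rw [div_pow, Real.sq_sqrt hD.le, le_div_iff₀ hD]
  calc _ ≤ R.card * n * D := mul_le_mul_of_nonneg_right h1 hD.le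
    _ = R.card * D * n := by ring
    _ ≤ n * n := mul_le_mul_of_nonneg_right hR (Nat.cast_nonneg n)
    _ = _ := (sq _).symm

/-- The difference is supported on pairs that meet `R`. As `R` has at most `n / D` elements,
Cauchy–Schwarz gives `∑ i ∈ R, |u i| ≤ n / √D`. -/
theorem removed_sum_le {n : ℕ} {D : ℝ} (hD : 0 < D) (hn : 0 < n) {R : Finset (Fin n)}
    (hR : R.card * D ≤ n) {P : Matrix (Fin n) (Fin n) ℝ} (hP : ∀ i j, P i j ∈ Set.Icc 0 (D / n))
    {u v u' v' : Fin n → ℝ} (hu : ∑ i, u i ^ 2 ≤ n) (hv : ∑ i, v i ^ 2 ≤ n)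
    (hu' : ∀ i, u' i = if i ∈ R then 0 else u i) (hv' : ∀ i, v' i = if i ∈ R then 0 else v i) :
    |∑ i, ∑ j, (u i * v j - u' i * v' j) * P i j| ≤ 2 * (n * √D) := by
  have hn' : (0 : ℝ) < n := by exact_mod_cast hn
  have hsD : 0 < √D := Real.sqrt_pos.2 hD
  have hterm : ∀ i j, |(u i * v j - u' i * v' j) * P i j| ≤
      ((if i ∈ R then |u i| else 0) * |v j| + |u i| * (if j ∈ R then |v j| else 0)) * (D / n) := by
    intro i j
    rw [abs_mul, abs_of_nonneg (hP i j).1]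
    refine mul_le_mul ?_ (hP i j).2 (hP i j).1 (by positivity)
    rw [hu', hv']
    have h0 : 0 ≤ |u i| * |v j| := by positivity
    split_ifs <;> simp [abs_mul, h0]
  have hsumR : ∀ w : Fin n → ℝ, ∑ i, (if i ∈ R then |w i| else 0) = ∑ i ∈ R, |w i| := by
    intro w
    rw [Finset.sum_ite_mem, Finset.univ_inter]
  calc _ ≤ ∑ i, ∑ j, ((if i ∈ R then |u i| else 0) * |v j| +
        |u i| * (if j ∈ R then |v j| else 0)) * (D / n) :=
        (Finset.abs_sum_le_sum_abs _ _).trans (Finset.sum_le_sum fun i _ =>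
          (Finset.abs_sum_le_sum_abs _ _).trans (Finset.sum_le_sum fun j _ => hterm i j))
    _ = ((∑ i ∈ R, |u i|) * ∑ j, |v j| + (∑ i, |u i|) * ∑ j ∈ R, |v j|) * (D / n) := by
        rw [← hsumR u, ← hsumR v, Finset.sum_mul_sum, Finset.sum_mul_sum,
          ← Finset.sum_add_distrib, Finset.sum_mul]
        refine Finset.sum_congr rfl fun i _ => ?_
        rw [← Finset.sum_add_distrib, Finset.sum_mul]
    _ ≤ (n / √D * n + n * (n / √D)) * (D / n) := by
        have h1 := sum_abs_subset_le hD hR hu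
        have h2 := sum_abs_subset_le hD hR hv
        have h3 := sum_abs_le hu
        have h4 := sum_abs_le hv
        gcongr
    _ = 2 * (n * (D / √D)) := by field_simp; ring
    _ = _ := by rw [Real.div_sqrt]

theorem diagonal_sum_le {n : ℕ} {b : ℝ} (hb : 0 ≤ b) {M : Matrix (Fin n) (Fin n) ℝ}
    (hoff : ∀ i j, i ≠ j → M i j = 0) (hM : ∀ i, |M i i| ≤ b) {u v : Fin n → ℝ}
    (hu : ∑ i, u i ^ 2 ≤ n) (hv : ∑ i, v i ^ 2 ≤ n) :
    |∑ i, ∑ j, u i * v j * M i j| ≤ n * b := by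
  have h1 : ∀ i, ∑ j, u i * v j * M i j = u i * v i * M i i := by
    intro i
    refine Finset.sum_eq_single i (fun j _ hji => ?_) (by simp)
    rw [hoff i j hji.symm, mul_zero]
  simp only [h1]
  calc _ ≤ ∑ i, (u i ^ 2 + v i ^ 2) / 2 * b := by
        refine (Finset.abs_sum_le_sum_abs _ _).trans (Finset.sum_le_sum fun i _ => ?_)
        rw [abs_mul]
        refine mul_le_mul ?_ (hM i) (abs_nonneg _) (by positivity)
        rw [abs_mul, ← sq_abs (u i), ← sq_abs (v i)]
        nlinarith [sq_nonneg (|u i| - |v i|)]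
    _ = (∑ i, u i ^ 2 + ∑ i, v i ^ 2) / 2 * b := by
        rw [← Finset.sum_mul, ← Finset.sum_div, Finset.sum_add_distrib]
    _ ≤ n * b := mul_le_mul_of_nonneg_right (by linarith) hb

/-- A bilinear form splits into its light part and a remainder on the heavy pairs. -/
theorem abs_bilinear_le_light_add_heavy {n : ℕ} (s : ℕ) (u v : Fin n → ℝ)
    {A Q : Matrix (Fin n) (Fin n) ℝ} (hQ : ∀ i j, 0 ≤ Q i j) (hA : ∀ i j, 0 ≤ A i j) :
    |∑ i, ∑ j, u i * v j * (A i j - Q i j)| ≤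
      |∑ i, ∑ j, lightPart s u v i j * (A i j - Q i j)| +
      ∑ i, ∑ j, (if dyadicLevel (u i) + dyadicLevel (v j) ≤ s then 0
        else |u i| * |v j| * A i j) +
      ∑ i, ∑ j, (if dyadicLevel (u i) + dyadicLevel (v j) ≤ s then 0
        else |u i| * |v j|) * Q i j := by
  have h1 : ∑ i, ∑ j, u i * v j * (A i j - Q i j) =
      ∑ i, ∑ j, lightPart s u v i j * (A i j - Q i j) +
      ∑ i, ∑ j, (u i * v j - lightPart s u v i j) * (A i j - Q i j) := by
    simp only [← Finset.sum_add_distrib]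
    exact Finset.sum_congr rfl fun i _ => Finset.sum_congr rfl fun j _ => by ring
  rw [h1, add_assoc]
  refine (abs_add_le _ _).trans (add_le_add_right ?_ _)
  simp only [← Finset.sum_add_distrib]
  refine (Finset.abs_sum_le_sum_abs _ _).trans (Finset.sum_le_sum fun i _ =>
    (Finset.abs_sum_le_sum_abs _ _).trans (Finset.sum_le_sum fun j _ => ?_))
  rw [lightPart]
  split_ifs with h
  · simp
  · rw [sub_zero, abs_mul, abs_mul, ← mul_add]
    refine mul_le_mul_of_nonneg_left ?_ (by positivity)
    rw [abs_le]
    constructor <;> linarith [hA i j, hQ i j]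

/-- This closure property lets the light bound, proved for `A`, be used after the random trimming.
-/
theorem restrict_mem_latticeNet {n : ℕ} {z : Fin n → ℤ} (hz : z ∈ latticeNet n)
    (R : Finset (Fin n)) : (fun i => if i ∈ R then 0 else z i) ∈ latticeNet n := by
  rw [mem_latticeNet] at hz ⊢
  refine (Finset.sum_le_sum fun i _ => ?_).trans hz
  split_ifs <;> simp

theorem sum_restrict_sq_le {n : ℕ} {z : Fin n → ℤ} (hz : ∑ i, ((z i : ℝ) / 4) ^ 2 ≤ (n : ℝ))
    (R : Finset (Fin n)) : ∑ i, (((if i ∈ R then 0 else z i : ℤ) : ℝ) / 4) ^ 2 ≤ (n : ℝ) := by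
  refine (Finset.sum_le_sum fun i _ => ?_).trans hz
  split_ifs
  · simp; positivity
  · exact le_rfl

/-- The deterministic part of the argument: concentration of the processed matrix follows from the
discrepancy bound, the bound on the light pairs and a lower bound for the total weight. -/
theorem matrixSpectralNorm_processedMatrix_sub_le {n s : ℕ} {C c B D κ : ℝ} (hn : 0 < n)
    (hC : 0 < C) (hc : 0 < c) (hB : 0 ≤ B) (hD1 : 1 ≤ D) (hκ : 0 ≤ κ)
    (hs : 2 ^ s ≤ √D) (hs' : √D ≤ 2 * 2 ^ s) (hDκ : √D ≤ κ * n)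
    {A P Q : Matrix (Fin n) (Fin n) ℝ} (hA : ∀ i j, 0 ≤ A i j) (hsymm : ∀ i j, A i j = A j i)
    (hP : ∀ i j, P i j ∈ Set.Icc 0 (D / n)) (hQ : ∀ i j, Q i j ∈ Set.Icc 0 (D / n))
    (hPQ : ∀ i j, i ≠ j → P i j = Q i j) (hdisc : HasBoundedDiscrepancy C D A)
    (hlight : HasLightBound s (B * (n * √D)) A Q) (htotal : c * (n * D) ≤ ∑ i, ∑ j, A i j) :
    matrixSpectralNorm (processedMatrix (4 * C / c) A - P) ≤
      2 * ((B + 64 * C ^ 2 / c + 104 * C + κ + 6) * √D) := by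
  classical
  have hn' : (0 : ℝ) < n := by exact_mod_cast hn
  have hD : 0 < D := by linarith
  have hsD : 0 < √D := Real.sqrt_pos.2 hD
  have hDn : √D * √D = D := Real.mul_self_sqrt hD.le
  have havg : c * D ≤ 1 / n * ∑ i, ∑ j, A i j := by
    rw [one_div, le_inv_mul_iff₀ hn']
    linarith
  set R : Finset (Fin n) := Finset.univ.filter fun i => IsRemoved (4 * C / c) A i with hR
  have hRcard : R.card * D ≤ n := by
    refine hdisc.card_mul_le hC hn fun i hi => ?_
    refine le_trans ?_ (Finset.mem_filter.1 hi).2.le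
    -- The threshold `4 * C / c` is chosen so that every removed row reaches `4 * C * D`, as
    -- `card_mul_le` requires.
    calc 4 * C * D = 4 * C / c * (c * D) := by field_simp
      _ ≤ _ := mul_le_mul_of_nonneg_left havg (by positivity)
  set A₀ := processedMatrix (4 * C / c) A with hA₀
  have hA₀0 : ∀ i j, 0 ≤ A₀ i j := processedMatrix_nonneg _ hA
  have hrow : ∀ i, ∑ j, A₀ i j ≤ 16 * C ^ 2 / c * D := by
    refine sum_processedMatrix_le (by positivity) hA ?_
    have h1 : ∑ i, ∑ j, A i j ≤ 4 * C * D * n := by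
      have h2 := hdisc.sum_rows_le hC.le hn Finset.univ
      rw [Finset.card_univ, Fintype.card_fin] at h2
      have h3 : 2 * C * (D * n + n) ≤ 2 * C * (D * n + D * n) := by
        refine mul_le_mul_of_nonneg_left ?_ (by positivity)
        nlinarith
      linarith
    calc _ ≤ 4 * C / c * (1 / n * (4 * C * D * n)) := by gcongr
      _ = _ := by field_simp; ring
  have hcol : ∀ j, ∑ i, A₀ i j ≤ 16 * C ^ 2 / c * D := by
    intro j
    simp only [hA₀, processedMatrix_comm (4 * C / c) hsymm _ j]
    exact hrow j
  have hdisc₀ : HasBoundedDiscrepancy C D A₀ := hdisc.mono (processedMatrix_le _ hA)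
  refine matrixSpectralNorm_le_of_latticeNet hn _ (by positivity) fun z hz w hw hz1 hw1 => ?_
  set u : Fin n → ℝ := fun i => (z i : ℝ) / 4 with hu
  set v : Fin n → ℝ := fun i => (w i : ℝ) / 4 with hv
  set u' : Fin n → ℝ := fun i => ((if i ∈ R then 0 else z i : ℤ) : ℝ) / 4 with hu'
  set v' : Fin n → ℝ := fun i => ((if i ∈ R then 0 else w i : ℤ) : ℝ) / 4 with hv'
  have huu : ∀ i, u' i = if i ∈ R then 0 else u i := by
    intro i; simp only [hu', hu]; split_ifs <;> simp
  have hvv : ∀ i, v' i = if i ∈ R then 0 else v i := by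
    intro i; simp only [hv', hv]; split_ifs <;> simp
  have hu'1 : ∑ i, u' i ^ 2 ≤ (n : ℝ) := sum_restrict_sq_le hz1 R
  have hv'1 : ∑ i, v' i ^ 2 ≤ (n : ℝ) := sum_restrict_sq_le hw1 R
  have hentry : ∀ i j, A₀ i j = if i ∈ R ∨ j ∈ R then 0 else A i j := by
    intro i j
    simp only [hA₀, processedMatrix, Matrix.of_apply, hR, Finset.mem_filter, Finset.mem_univ,
      true_and]
  -- The processed matrix tested on `u`, `v` is `A` tested on the restricted `u'`, `v'`. What
  -- remains is the diagonal of `Q - P` and the part of `P` on removed rows and columns.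
  have hsplit : ∑ i, ∑ j, u i * v j * (A₀ - P) i j =
      ∑ i, ∑ j, u' i * v' j * (A i j - Q i j) + ∑ i, ∑ j, u' i * v' j * (Q - P) i j -
        ∑ i, ∑ j, (u i * v j - u' i * v' j) * P i j := by
    simp only [← Finset.sum_add_distrib, ← Finset.sum_sub_distrib]
    refine Finset.sum_congr rfl fun i _ => Finset.sum_congr rfl fun j _ => ?_
    rw [Matrix.sub_apply, Matrix.sub_apply, hentry, huu, hvv]
    by_cases hi : i ∈ R <;> by_cases hj : j ∈ R <;> simp only [hi, hj, or_self, or_true, or_false,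
      if_true, if_false] <;> ring
  have hdiag : |∑ i, ∑ j, u' i * v' j * (Q - P) i j| ≤ κ * (n * √D) := by
    refine (diagonal_sum_le (b := D / n) (by positivity) (fun i j hij => ?_) (fun i => ?_)
      hu'1 hv'1).trans ?_
    · rw [Matrix.sub_apply, hPQ i j hij, sub_self]
    · rw [Matrix.sub_apply, abs_le]
      constructor <;> linarith [(hP i i).1, (hP i i).2, (hQ i i).1, (hQ i i).2]
    · rw [mul_div_cancel₀ _ hn'.ne']
      linarith [mul_le_mul_of_nonneg_right hDκ hsD.le]
  have hremoved := removed_sum_le hD hn hRcard hP hz1 hw1 huu hvv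
  have hlight' : |∑ i, ∑ j, lightPart s u' v' i j * (A i j - Q i j)| ≤ B * (n * √D) :=
    hlight _ (restrict_mem_latticeNet hz R) _ (restrict_mem_latticeNet hw R) hu'1 hv'1
  have hheavy := heavy_sum_le hC.le (L := 16 * C ^ 2 / c) (by positivity) hD.le hs hs' hA₀0 hrow
    hcol hdisc₀ hu'1 hv'1
  -- On restricted vectors `A` and `A₀` agree, so the heavy part may use the row bounds, which hold
  -- only for `A₀`.
  have hheavyA : ∑ i, ∑ j, (if dyadicLevel (u' i) + dyadicLevel (v' j) ≤ s then 0
      else |u' i| * |v' j| * A i j) = ∑ i, ∑ j, (if dyadicLevel (u' i) + dyadicLevel (v' j) ≤ s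
        then 0 else |u' i| * |v' j| * A₀ i j) := by
    refine Finset.sum_congr rfl fun i _ => Finset.sum_congr rfl fun j _ => ?_
    rw [hentry]
    congr 1
    by_cases hi : i ∈ R
    · rw [huu i, if_pos hi]; simp
    by_cases hj : j ∈ R
    · rw [hvv j, if_pos hj]; simp
    rw [if_neg (by tauto)]
  have hheavyQ : ∑ i, ∑ j, (if dyadicLevel (u' i) + dyadicLevel (v' j) ≤ s then 0
      else |u' i| * |v' j|) * Q i j ≤ 4 * (n * √D) := by
    calc _ ≤ ∑ i, ∑ j, (if dyadicLevel (u' i) + dyadicLevel (v' j) ≤ s then 0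
          else |u' i| * |v' j|) * (D / n) := by
          refine Finset.sum_le_sum fun i _ => Finset.sum_le_sum fun j _ =>
            mul_le_mul_of_nonneg_left (hQ i j).2 ?_
          split_ifs <;> positivity
      _ = (∑ i, ∑ j, (if dyadicLevel (u' i) + dyadicLevel (v' j) ≤ s then 0
          else |u' i| * |v' j|)) * (D / n) := by
          simp only [Finset.sum_mul]
      _ ≤ 4 * n ^ 2 / √D * (D / n) :=
          mul_le_mul_of_nonneg_right (heavy_mean_sum_le hD hs' hu'1 hv'1) (by positivity)
      _ = 4 * (n * (D / √D)) := by field_simp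
      _ = _ := by rw [Real.div_sqrt]
  have hmain := abs_bilinear_le_light_add_heavy s u' v' (fun i j => (hQ i j).1) hA
  rw [hheavyA] at hmain
  rw [hsplit]
  refine (abs_sub _ _).trans ((add_le_add_left (abs_add_le _ _) _).trans ?_)
  have hfinal : (B + 64 * C ^ 2 / c + 104 * C + κ + 6) * √D * n = B * (n * √D) +
      (4 * (16 * C ^ 2 / c) + 104 * C) * (n * √D) + 4 * (n * √D) + κ * (n * √D) +
        2 * (n * √D) := by ring
  rw [hfinal]
  linarith

theorem IsWeightedSBM.le_measure_spectralNorm_le {Ω : Type*} [MeasurableSpace Ω] {μ : Measure Ω}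
    [IsProbabilityMeasure μ] {n d k : ℕ} {Ψ : Fin n → Fin k} {p q α κ : ℝ}
    {W : HEdge n d → Ω → ℝ} (h : IsWeightedSBM μ Ψ p q α W) (hd : 2 ≤ d) (hn0 : 0 < n)
    (hn : 2 * (d : ℝ) * (k + 1) ≤ n) (hqp : q ≤ p) (hp : 0 ≤ p) (hα : 0 ≤ α) (hκ : 0 ≤ κ)
    (hD : 1 ≤ n * ((n - 2).choose (d - 2) : ℝ) * (p * α))
    (hDκ : √(n * ((n - 2).choose (d - 2) : ℝ) * (p * α)) ≤ κ * n) :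
    1 - (3 + 10 / homogeneousRatio d k) / n ≤ μ.real {ω |
      matrixSpectralNorm (processedMatrix (4 * (6 * d ^ 2) / (homogeneousRatio d k / 2))
          (similarityMatrix fun e => W e ω) - populationMatrix μ Ψ W) ≤
        2 * ((152 * d ^ 2 + 64 * (6 * d ^ 2) ^ 2 / (homogeneousRatio d k / 2) +
          104 * (6 * d ^ 2) + κ + 6) * √(n * ((n - 2).choose (d - 2) : ℝ) * (p * α)))} := by
  have hn' : (0 : ℝ) < n := by exact_mod_cast hn0
  have hd0 : (0 : ℝ) < d := by exact_mod_cast (by omega : 0 < d)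
  have hpα : 0 ≤ p * α := mul_nonneg hp hα
  have hc := homogeneousRatio_pos d k
  have hmean := h.mean_le hqp hα
  set D : ℝ := n * ((n - 2).choose (d - 2) : ℝ) * (p * α) with hDdef
  have hDn : ((n - 2).choose (d - 2) : ℝ) * (p * α) = D / n := by
    rw [hDdef]; field_simp
  -- The cut level `s` satisfies `2^s ≤ √D < 2^(s+1)`; it exists because `D ≥ 1`.
  obtain ⟨s, hs, hs'⟩ := exists_nat_pow_near (Real.one_le_sqrt.2 hD) one_lt_two
  have hs2 : √D ≤ 2 * 2 ^ s := by rw [pow_succ] at hs'; linarith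
  set Q := similarityMatrix fun e => ∫ ω, W e ω ∂μ with hQ
  set E₁ : Set Ω := {ω | ¬ HasBoundedDiscrepancy (6 * d ^ 2) D
    (similarityMatrix fun e => W e ω)} with hE₁
  set E₂ : Set Ω := {ω | ¬ HasLightBound s (38 * n * (d ^ 2 * (4 * 2 ^ s)))
    (similarityMatrix fun e => W e ω) Q} with hE₂
  set E₃ : Set Ω := {ω | ∑ e, W e ω ≤ homogeneousRatio d k * (n * D) / 2} with hE₃
  have h1 : μ.real E₁ ≤ 1 / n := measure_not_hasBoundedDiscrepancy_le hd h.measurable_weight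
    h.weight_mem h.indep hpα hmean hn0
  have h2 : μ.real E₂ ≤ 2 / n := measure_not_hasLightBound_le hd h.measurable_weight
    h.weight_mem h.indep hmean hpα hn0 hs2
  have h3 : μ.real E₃ ≤ 10 / homogeneousRatio d k / n := by
    refine (measure_sum_le_half_mean_le h.measurable_weight h.weight_mem h.indep (by positivity)
      (h.le_sum_mean hd hpα hn hn0)).trans ?_
    rw [div_div]
    refine div_le_div_of_nonneg_left (by norm_num) (by positivity) ?_
    exact mul_le_mul_of_nonneg_left (le_mul_of_one_le_right hn'.le hD) hc.le
  set G : Set Ω := {ω | matrixSpectralNorm (processedMatrix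
    (4 * (6 * d ^ 2) / (homogeneousRatio d k / 2)) (similarityMatrix fun e => W e ω) -
      populationMatrix μ Ψ W) ≤ 2 * ((152 * d ^ 2 + 64 * (6 * d ^ 2) ^ 2 /
        (homogeneousRatio d k / 2) + 104 * (6 * d ^ 2) + κ + 6) * √D)} with hG
  -- Covering the whole space and using subadditivity avoids any measurability of the good event.
  have hcover : (Set.univ : Set Ω) ⊆ G ∪ (E₁ ∪ (E₂ ∪ E₃)) := by
    intro ω _
    by_contra hω
    simp only [Set.mem_union, not_or] at hω
    obtain ⟨hωG, hω1, hω2, hω3⟩ := hω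
    refine hωG ?_
    have hdisc := not_not.1 hω1
    have hlight := not_not.1 hω2
    have htot : homogeneousRatio d k * (n * D) / 2 < ∑ e, W e ω := not_le.1 hω3
    have hw0 : ∀ e, 0 ≤ W e ω := fun e => (h.weight_mem e ω).1
    refine matrixSpectralNorm_processedMatrix_sub_le (s := s) (Q := Q) hn0 (by positivity)
      (by positivity) (by positivity) hD hκ hs hs2 hDκ (similarityMatrix_nonneg hw0)
      (similarityMatrix_comm _) (fun i j => ?_) (fun i j => ?_)
      (fun i j hij => h.populationMatrix_eq hij) hdisc ?_ ?_
    · rw [← hDn]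
      exact h.populationMatrix_mem_Icc hqp hα hp i j
    · rw [← hDn]
      exact ⟨similarityMatrix_nonneg h.mean_nonneg i j, similarityMatrix_le hpα hmean i j⟩
    · intro z hz w hw hz1 hw1
      refine (hlight z hz w hw hz1 hw1).trans ?_
      calc 38 * n * (d ^ 2 * (4 * 2 ^ s)) = 152 * (d : ℝ) ^ 2 * (n * 2 ^ s) := by ring
        _ ≤ _ := by gcongr
    · refine le_trans ?_ (sum_le_sum_similarityMatrix hd hw0)
      linarith
  have hmass : 1 ≤ μ.real G + (μ.real E₁ + (μ.real E₂ + μ.real E₃)) := by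
    calc (1 : ℝ) = μ.real Set.univ := probReal_univ.symm
      _ ≤ μ.real (G ∪ (E₁ ∪ (E₂ ∪ E₃))) := measureReal_mono hcover (measure_ne_top _ _)
      _ ≤ _ := (measureReal_union_le _ _).trans (add_le_add_right ((measureReal_union_le _ _).trans
          (add_le_add_right (measureReal_union_le _ _) _)) _)
  have hC : (3 + 10 / homogeneousRatio d k) / n =
      1 / n + (2 / n + 10 / homogeneousRatio d k / n) := by ring
  rw [hC]
  linarith

theorem mainTheorem4 (d k : ℕ) (hd : 2 ≤ d) :
    ∃ cthr > (0 : ℝ), ∃ c₅ > (0 : ℝ), ∃ C > (0 : ℝ),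
      ∀ p q K : ℝ, 0 ≤ q → q < p → ∃ c₄ > (0 : ℝ),
        ∀ (n : ℕ) (Ψ : Fin n → Fin k) (α : ℝ)
          (Ω : Type*) [MeasurableSpace Ω] (μ : Measure Ω) [IsProbabilityMeasure μ]
          (W : HEdge n d → Ω → ℝ),
          IsWeightedSBM μ Ψ p q α W →
          c₅ ≤ n * ((n - 2).choose (d - 2) : ℝ) * p * α →
          ((n - 2).choose (d - 2) : ℝ) * α ≤ K * n →
          1 - C / n ≤ μ.real {ω |
            matrixSpectralNorm
                (processedMatrix cthr (similarityMatrix fun e => W e ω) - populationMatrix μ Ψ W)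
              ≤ c₄ * √(n * ((n - 2).choose (d - 2) : ℝ) * α)} := by
  have hc := homogeneousRatio_pos d k
  have hd0 : (0 : ℝ) < d := by exact_mod_cast (by omega : 0 < d)
  -- The threshold is `4 * C / c` with discrepancy constant `C = 6 d²` and `c` half the homogeneous
  -- ratio; `c₅ = 1` gives `D ≥ 1`. The last summand of the probability constant makes the claim
  -- trivial for `n < 2 d (k + 1)`.
  refine ⟨4 * (6 * d ^ 2) / (homogeneousRatio d k / 2), by positivity, 1, one_pos,
    3 + 10 / homogeneousRatio d k + 2 * d * (k + 1), by positivity, fun p q K hq hqp => ?_⟩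
  have hp : 0 < p := hq.trans_lt hqp
  refine ⟨2 * (152 * d ^ 2 + 64 * (6 * d ^ 2) ^ 2 / (homogeneousRatio d k / 2) +
    104 * (6 * d ^ 2) + √(p * K) + 6) * √p, by positivity, ?_⟩
  intro n Ψ α Ω _ μ _ W hW hD hK
  rw [mul_assoc _ p α] at hD
  have hn0 : 0 < n := by
    rcases Nat.eq_zero_or_pos n with rfl | hn0
    · rw [Nat.cast_zero, zero_mul, zero_mul] at hD
      linarith
    · exact hn0
  have hn' : (0 : ℝ) < n := by exact_mod_cast hn0
  have hα : 0 ≤ α := by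
    by_contra hα
    have h1 : p * α ≤ 0 := mul_nonpos_of_nonneg_of_nonpos hp.le (not_le.1 hα).le
    have h2 : (n : ℝ) * ((n - 2).choose (d - 2) : ℝ) * (p * α) ≤ 0 :=
      mul_nonpos_of_nonneg_of_nonpos (by positivity) h1
    linarith
  rcases le_or_gt (2 * (d : ℝ) * (k + 1)) n with hn | hn
  -- The upper bound on `α` enters only here, to give `κ = √(p * K)` for the diagonal term.
  · have hDκ : √(n * ((n - 2).choose (d - 2) : ℝ) * (p * α)) ≤ √(p * K) * n := by
      rw [← Real.sqrt_sq hn'.le, ← Real.sqrt_mul' _ (sq_nonneg (n : ℝ)), Real.sqrt_sq hn'.le]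
      refine Real.sqrt_le_sqrt ?_
      calc (n : ℝ) * ((n - 2).choose (d - 2) : ℝ) * (p * α) =
            n * p * (((n - 2).choose (d - 2) : ℝ) * α) := by ring
        _ ≤ n * p * (K * n) := mul_le_mul_of_nonneg_left hK (by positivity)
        _ = _ := by ring
    have hmain := hW.le_measure_spectralNorm_le hd hn0 hn hqp.le hp.le hα (Real.sqrt_nonneg _)
      hD hDκ
    have hsqrt : √(n * ((n - 2).choose (d - 2) : ℝ) * (p * α)) =
        √p * √(n * ((n - 2).choose (d - 2) : ℝ) * α) := by
      rw [← Real.sqrt_mul hp.le]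
      ring_nf
    rw [hsqrt] at hmain
    simp only [← mul_assoc] at hmain ⊢
    refine le_trans (sub_le_sub_left (div_le_div_of_nonneg_right ?_ hn'.le) 1) hmain
    linarith [show (0 : ℝ) ≤ 2 * d * (k + 1) by positivity]
  · refine le_trans ?_ measureReal_nonneg
    rw [sub_nonpos, one_le_div hn']
    have : 0 < 10 / homogeneousRatio d k := by positivity
    linarith
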